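/- Let $\mathbb N=\{1,2,3,\dots\}$, let $$s=\{x\in\mathbb C^{\mathbb N}:\ \sup_i i^r|x_i|<\infty\ \text{ for all } r\in\mathbb N_0\}$$ be the space of rapidly decreasing sequences, topologized by the seminorms $x\mapsto\sup_i i^r|x_i|$, $r\in\mathbb N_0$. For $1\le p\le\infty$ and $k\in\mathbb Z$ let $(\ell^p)_{-k}=\{x\in\mathbb C^{\mathbb N}: (j^{-k}x_j)_j\in\ell^p\}$ with norm $\|(j^{-k}x_j)_j\|_{\ell^p}$, and let $(c_0)_{-k}=\{x\in\mathbb C^{\mathbb N}: j^{-k}x_j\to0\}$ with norm $\sup_j j^{-k}|x_j|$. Let $s\,\widehat\otimes\, F$ denote the completed projective tensor product, i.e. the completion of $s\otimes F$ for the finest locally convex topology that makes the canonical bilinear map $s\times F\to s\otimes F$ continuous. **Proposition.** Let $1\le p\le\infty$, and let $E_k=s\,\widehat\otimes\,(\ell^p)_{-k}$ for all $k\in\mathbb Z$, or $E_k=s\,\widehat\otimes\,(c_0)_{-k}$ for all $k\in\mathbb Z$. For $k\le l$ let $E_k\to E_l$ be the continuous linear extension of $\mathrm{id}\otimes\iota$,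 where $\iota$ is the inclusion $(\ell^p)_{-k}\subseteq(\ell^p)_{-l}$, respectively $(c_0)_{-k}\subseteq(c_0)_{-l}$. Let $E=\operatorname{ind\,lim}_k E_k$ be the inductive limit of the $E_k$ along these maps, with the finest locally convex topology for which all canonical maps $E_k\to E$ are continuous. Then: 1. $E$ is an LF-space: every $E_k$ is a Fréchet space, the maps $E_k\to E_l$ are injective and compatible with composition, and $E$ is Hausdorff. 2. $E$ is compactly regular: every compact subset of $E$ is contained in some step $E_k$ and is compact in $E_k$. 3. $E$ is complete. -/

import Mathlib

open scoped TensorProduct ENNReal Topology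

noncomputable section

/-! ### Finest locally convex topologies -/

/-- `t` is a locally convex vector space topology on the complex vector space `V`. -/
def IsLocallyConvexTopology (V : Type*) [AddCommGroup V] [Module ℂ V]
    (t : TopologicalSpace V) : Prop :=
  @IsTopologicalAddGroup V t _ ∧ @ContinuousSMul ℂ V _ _ t ∧ @LocallyConvexSpace ℝ V _ _ _ _ t

/-- The supremum of all locally convex topologies on `V` that satisfy `P` (in Mathlib's order on
topologies this is an `sInf`). If `P` says that certain maps into `V` are continuous, then this
topology itself satisfies `P`, and so it is the finest locally convex topology satisfying `P`. -/
@[reducible]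
def finestLocallyConvex (V : Type*) [AddCommGroup V] [Module ℂ V]
    (P : TopologicalSpace V → Prop) : TopologicalSpace V :=
  sInf {t | IsLocallyConvexTopology V t ∧ P t}

theorem isLocallyConvexTopology_finest (V : Type*) [AddCommGroup V] [Module ℂ V]
    (P : TopologicalSpace V → Prop) :
    IsLocallyConvexTopology V (finestLocallyConvex V P) :=
  ⟨topologicalAddGroup_sInf fun _ ht => ht.1.1, continuousSMul_sInf fun _ ht => ht.1.2.1,
    LocallyConvexSpace.sInf fun _ ht => ht.1.2.2⟩

/-- The uniform structure of the additive topological group `(V, finestLocallyConvex V P)`. -/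
@[reducible]
def finestLocallyConvexUniform (V : Type*) [AddCommGroup V] [Module ℂ V]
    (P : TopologicalSpace V → Prop) : UniformSpace V :=
  @IsTopologicalAddGroup.rightUniformSpace V _ (finestLocallyConvex V P)
    (isLocallyConvexTopology_finest V P).1

theorem isUniformAddGroup_finest (V : Type*) [AddCommGroup V] [Module ℂ V]
    (P : TopologicalSpace V → Prop) :
    @IsUniformAddGroup V (finestLocallyConvexUniform V P) _ :=
  @isUniformAddGroup_of_addCommGroup V _ (finestLocallyConvex V P)
    (isLocallyConvexTopology_finest V P).1

/-! ### The completed projective tensor product -/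

section ProjectiveTensor

variable (E F G : Type*)
  [AddCommGroup E] [Module ℂ E] [TopologicalSpace E]
  [AddCommGroup F] [Module ℂ F] [TopologicalSpace F]
  [AddCommGroup G] [Module ℂ G] [TopologicalSpace G]

/-- The algebraic tensor product `E ⊗ F`, to be equipped with the `π`-topology. -/
def ProjTensor : Type _ := E ⊗[ℂ] F

instance : AddCommGroup (ProjTensor E F) := inferInstanceAs (AddCommGroup (E ⊗[ℂ] F))

instance : Module ℂ (ProjTensor E F) := inferInstanceAs (Module ℂ (E ⊗[ℂ] F))

/-- The canonical bilinear map `E × F → E ⊗ F`. -/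
def ProjTensor.mk : E →ₗ[ℂ] F →ₗ[ℂ] ProjTensor E F := TensorProduct.mk ℂ E F

/-- The projective topology: the finest locally convex topology on `E ⊗ F` for which the canonical
bilinear map `E × F → E ⊗ F` is (jointly) continuous. -/
instance : UniformSpace (ProjTensor E F) :=
  finestLocallyConvexUniform (ProjTensor E F) fun t =>
    @Continuous (E × F) (ProjTensor E F) _ t fun x => ProjTensor.mk E F x.1 x.2

instance : IsUniformAddGroup (ProjTensor E F) := isUniformAddGroup_finest _ _

instance : ContinuousSMul ℂ (ProjTensor E F) := (isLocallyConvexTopology_finest _ _).2.1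

instance : UniformContinuousConstSMul ℂ (ProjTensor E F) :=
  uniformContinuousConstSMul_of_continuousConstSMul ℂ (ProjTensor E F)

instance : LocallyConvexSpace ℝ (ProjTensor E F) := (isLocallyConvexTopology_finest _ _).2.2

theorem ProjTensor.continuous_mk :
    Continuous fun x : E × F => ProjTensor.mk E F x.1 x.2 :=
  continuous_sInf_rng.2 fun _ ht => ht.2

/-- The completed projective tensor product of `E` and `F`. -/
abbrev CompletedTensor : Type _ := UniformSpace.Completion (ProjTensor E F)

variable {F G}

/-- The algebraic map `id ⊗ g : E ⊗ F → E ⊗ G`. -/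
def ProjTensor.lTensorLinear (g : F →L[ℂ] G) : ProjTensor E F →ₗ[ℂ] ProjTensor E G :=
  LinearMap.lTensor E g.toLinearMap

/-- `id ⊗ g : E ⊗ F → E ⊗ G` is continuous for the projective topologies. -/
def ProjTensor.lTensor (g : F →L[ℂ] G) : ProjTensor E F →L[ℂ] ProjTensor E G where
  toLinearMap := ProjTensor.lTensorLinear E g
  cont := by
    refine continuous_iff_le_induced.2 (sInf_le ⟨⟨?_, ?_, ?_⟩, ?_⟩)
    · exact topologicalAddGroup_induced (ProjTensor.lTensorLinear E g)
    · exact continuousSMul_induced (ProjTensor.lTensorLinear E g)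
    · exact LocallyConvexSpace.induced ((ProjTensor.lTensorLinear E g).restrictScalars ℝ)
    · refine continuous_induced_rng.2 ?_
      exact (ProjTensor.continuous_mk E G).comp
        (continuous_fst.prodMk (g.continuous.comp continuous_snd))

theorem ProjTensor.completion_map_coe (g : F →L[ℂ] G) (a : ProjTensor E F) :
    UniformSpace.Completion.map (ProjTensor.lTensor E g) (a : CompletedTensor E F) =
      (ProjTensor.lTensor E g a : CompletedTensor E G) :=
  UniformSpace.Completion.map_coe (ProjTensor.lTensor E g).uniformContinuous a

/-- The continuous linear extension of `id ⊗ g` to the completed projective tensor products. -/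
def CompletedTensor.lTensor (g : F →L[ℂ] G) : CompletedTensor E F →L[ℂ] CompletedTensor E G where
  toFun := UniformSpace.Completion.map (ProjTensor.lTensor E g)
  map_add' x y := by
    have hc : Continuous (UniformSpace.Completion.map (ProjTensor.lTensor E g)) :=
      UniformSpace.Completion.continuous_map
    refine UniformSpace.Completion.induction_on₂ x y (isClosed_eq ?_ ?_) fun a b => ?_
    · exact hc.comp continuous_add
    · exact (hc.comp continuous_fst).add
        (hc.comp continuous_snd)
    · rw [← UniformSpace.Completion.coe_add, ProjTensor.completion_map_coe,
        ProjTensor.completion_map_coe, ProjTensor.completion_map_coe, map_add,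
        UniformSpace.Completion.coe_add]
  map_smul' c x := by
    refine UniformSpace.Completion.induction_on x (isClosed_eq ?_ ?_) fun a => ?_
    · exact UniformSpace.Completion.continuous_map.comp (continuous_const_smul c)
    · exact (continuous_const_smul c).comp UniformSpace.Completion.continuous_map
    · rw [← UniformSpace.Completion.coe_smul, ProjTensor.completion_map_coe,
        ProjTensor.completion_map_coe, map_smul, UniformSpace.Completion.coe_smul,
        RingHom.id_apply]
  cont := UniformSpace.Completion.continuous_map

end ProjectiveTensor

/-! ### Locally convex inductive limits -/

section InductiveLimit

variable (E : ℤ → Type*) [∀ k, AddCommGroup (E k)] [∀ k, Module ℂ (E k)]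
  [∀ k, UniformSpace (E k)]
  (f : ∀ k l : ℤ, k ≤ l → E k →L[ℂ] E l)

/-- The algebraic inductive limit of the spectrum `(E k)` with linking maps `f k l`. -/
def IndLim : Type _ := Module.DirectLimit E fun k l h => (f k l h).toLinearMap

instance : AddCommGroup (IndLim E f) :=
  inferInstanceAs (AddCommGroup (Module.DirectLimit E fun k l h => (f k l h).toLinearMap))

instance : Module ℂ (IndLim E f) :=
  inferInstanceAs (Module ℂ (Module.DirectLimit E fun k l h => (f k l h).toLinearMap))

/-- The canonical map from the step `E k` to the inductive limit. -/
def IndLim.of (k : ℤ) : E k →ₗ[ℂ] IndLim E f :=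
  Module.DirectLimit.of ℂ ℤ E (fun k l h => (f k l h).toLinearMap) k

/-- The inductive limit topology: the finest locally convex topology for which the canonical maps
from the steps are continuous. -/
instance : UniformSpace (IndLim E f) :=
  finestLocallyConvexUniform (IndLim E f) fun t =>
    ∀ k, @Continuous (E k) (IndLim E f) _ t (IndLim.of E f k)

instance : IsUniformAddGroup (IndLim E f) := isUniformAddGroup_finest _ _

instance : ContinuousSMul ℂ (IndLim E f) := (isLocallyConvexTopology_finest _ _).2.1

instance : LocallyConvexSpace ℝ (IndLim E f) := (isLocallyConvexTopology_finest _ _).2.2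

/-- A Fréchet space: a complete metrizable locally convex space. -/
structure IsFrechetSpace (V : Type*) [AddCommGroup V] [Module ℂ V] [UniformSpace V] : Prop where
  isUniformAddGroup : IsUniformAddGroup V
  continuousSMul : ContinuousSMul ℂ V
  locallyConvex : LocallyConvexSpace ℝ V
  metrizable : TopologicalSpace.MetrizableSpace V
  complete : CompleteSpace V

/-- `(E k)` is a spectrum of Fréchet spaces with continuous injective linking maps, and its
locally convex inductive limit is Hausdorff: the inductive limit is an LF-space. -/
structure IsLFSpace : Prop where
  frechet : ∀ k, IsFrechetSpace (E k)
  map_self : ∀ k (x : E k), f k k le_rfl x = x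
  map_map : ∀ k l m (hkl : k ≤ l) (hlm : l ≤ m) (x : E k),
    f l m hlm (f k l hkl x) = f k m (hkl.trans hlm) x
  injective : ∀ k l (h : k ≤ l), Function.Injective (f k l h)
  hausdorff : T2Space (IndLim E f)

/-- Every compact subset of the inductive limit is contained in a step and is compact there. -/
def IsCompactlyRegular : Prop :=
  ∀ K : Set (IndLim E f), IsCompact K →
    ∃ k : ℤ, K ⊆ Set.range (IndLim.of E f k) ∧ IsCompact (IndLim.of E f k ⁻¹' K)

end InductiveLimit

/-! ### The weighted sequence spaces; the index set `{1, 2, 3, …}` is `ℕ+` -/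

/-- Multiplication of the sequence `x` with the weight `j ^ (-k)`. -/
def weight (k : ℤ) : (ℕ+ → ℂ) →ₗ[ℂ] (ℕ+ → ℂ) where
  toFun x j := ((j : ℕ) : ℂ) ^ (-k) * x j
  map_add' x y := by ext j; simp [mul_add]
  map_smul' c x := by ext j; simp [mul_left_comm]

theorem weight_injective (k : ℤ) : Function.Injective (weight k) := by
  intro x y h
  ext j
  have hj : ((j : ℕ) : ℂ) ^ (-k) ≠ 0 := zpow_ne_zero _ (Nat.cast_ne_zero.2 j.ne_zero)
  exact mul_left_cancel₀ hj (congrFun h j)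

section WeightedLp

variable (p : ℝ≥0∞) (k : ℤ)

/-- `(ℓ^p)_{-k}` as a subspace of `ℂ^ℕ`. -/
def weightedLpSubmodule : Submodule ℂ (ℕ+ → ℂ) where
  carrier := {x | Memℓp (weight k x) p}
  add_mem' {x y} hx hy := by
    change Memℓp (weight k (x + y)) p
    rw [map_add]
    exact Memℓp.add hx hy
  zero_mem' := by
    change Memℓp (weight k 0) p
    rw [map_zero]
    exact zero_memℓp
  smul_mem' c x hx := by
    change Memℓp (weight k (c • x)) p
    rw [map_smul]
    exact Memℓp.const_smul hx c

/-- The space `(ℓ^p)_{-k}` of all sequences `x` such that `(j ^ (-k) * x j)_j` is in `ℓ^p`. -/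
def WeightedLp : Type := weightedLpSubmodule p k

instance : AddCommGroup (WeightedLp p k) := inferInstanceAs (AddCommGroup (weightedLpSubmodule p k))

instance : Module ℂ (WeightedLp p k) := inferInstanceAs (Module ℂ (weightedLpSubmodule p k))

/-- The map `x ↦ (j ^ (-k) * x j)_j` from `(ℓ^p)_{-k}` to `ℓ^p`. -/
def WeightedLp.toLp : WeightedLp p k →ₗ[ℂ] lp (fun _ : ℕ+ => ℂ) p where
  toFun x := ⟨weight k x.1, x.2⟩
  map_add' x y := Subtype.ext ((weight k).map_add x.1 y.1)
  map_smul' c x := Subtype.ext ((weight k).map_smul c x.1)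

theorem WeightedLp.toLp_injective : Function.Injective (WeightedLp.toLp p k) := fun _ _ h =>
  Subtype.ext (weight_injective k (congrArg Subtype.val h))

theorem norm_weight_le {k l : ℤ} (h : k ≤ l) (x : ℕ+ → ℂ) (j : ℕ+) : ‖weight l x j‖ ≤ ‖weight k x j‖ := by
  have hj : (1 : ℝ) ≤ ((j : ℕ) : ℝ) := by exact_mod_cast j.pos
  simp only [weight, LinearMap.coe_mk, AddHom.coe_mk, norm_mul, norm_zpow, Complex.norm_natCast]
  exact mul_le_mul_of_nonneg_right (zpow_le_zpow_right₀ hj (neg_le_neg h)) (norm_nonneg _)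

theorem mem_weightedLp_of_le {k l : ℤ} (h : k ≤ l) {x : ℕ+ → ℂ} (hx : x ∈ weightedLpSubmodule p k) :
    x ∈ weightedLpSubmodule p l :=
  Memℓp.mono' hx (norm_weight_le h x)

variable [Fact (1 ≤ p)]

/-- The norm of `x` in `(ℓ^p)_{-k}` is the `ℓ^p`-norm of `(j ^ (-k) * x j)_j`. -/
instance : NormedAddCommGroup (WeightedLp p k) :=
  NormedAddCommGroup.induced (WeightedLp p k) (lp (fun _ : ℕ+ => ℂ) p) (WeightedLp.toLp p k)
    (WeightedLp.toLp_injective p k)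

instance : NormedSpace ℂ (WeightedLp p k) :=
  NormedSpace.induced ℂ (WeightedLp p k) (lp (fun _ : ℕ+ => ℂ) p) (WeightedLp.toLp p k)

variable {k} {l : ℤ}

/-- The inclusion `(ℓ^p)_{-k} ⊆ (ℓ^p)_{-l}` for `k ≤ l`. -/
def WeightedLp.inclLinear (h : k ≤ l) : WeightedLp p k →ₗ[ℂ] WeightedLp p l :=
  Submodule.inclusion fun _ => mem_weightedLp_of_le p h

theorem WeightedLp.norm_incl_le (h : k ≤ l) (x : WeightedLp p k) :
    ‖WeightedLp.inclLinear p h x‖ ≤ 1 * ‖x‖ := by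
  rw [one_mul]
  change ‖WeightedLp.toLp p l (WeightedLp.inclLinear p h x)‖ ≤ ‖WeightedLp.toLp p k x‖
  exact lp.norm_mono (zero_lt_one.trans_le (Fact.out : 1 ≤ p)).ne' (norm_weight_le h x.1)

/-- The inclusion `(ℓ^p)_{-k} ⊆ (ℓ^p)_{-l}` is continuous. -/
def WeightedLp.incl (h : k ≤ l) : WeightedLp p k →L[ℂ] WeightedLp p l :=
  (WeightedLp.inclLinear p h).mkContinuous 1 (WeightedLp.norm_incl_le p h)

variable (k)

/-- The space `(c_0)_{-k}` of all sequences `x` with `j ^ (-k) * x j → 0`, normed as a subspace of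
`(ℓ^∞)_{-k}`. -/
def WeightedC0 : Submodule ℂ (WeightedLp ∞ k) where
  carrier := {x | Filter.Tendsto (weight k x.1) Filter.cofinite (𝓝 0)}
  add_mem' {x y} hx hy := by
    change Filter.Tendsto (weight k (x.1 + y.1)) Filter.cofinite (𝓝 0)
    rw [map_add, ← add_zero (0 : ℂ)]
    exact Filter.Tendsto.add hx hy
  zero_mem' := by
    change Filter.Tendsto (weight k 0) Filter.cofinite (𝓝 0)
    rw [map_zero]
    exact tendsto_const_nhds
  smul_mem' c x hx := by
    change Filter.Tendsto (weight k (c • x.1)) Filter.cofinite (𝓝 0)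
    rw [map_smul, ← smul_zero c]
    exact Filter.Tendsto.const_smul hx c

variable {k}

/-- The continuous inclusion `(c_0)_{-k} ⊆ (c_0)_{-l}` for `k ≤ l`. -/
def WeightedC0.incl (h : k ≤ l) : WeightedC0 k →L[ℂ] WeightedC0 l :=
  ((WeightedLp.incl ∞ h).comp (WeightedC0 k).subtypeL).codRestrict (WeightedC0 l) fun x =>
    squeeze_zero_norm (norm_weight_le h x.1.1) (tendsto_zero_iff_norm_tendsto_zero.1 x.2)

end WeightedLp

/-! ### The space of rapidly decreasing sequences -/

/-- The sequences `x` such that `(i ^ r * x i)_i` is bounded for all `r`. -/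
def rapidSubmodule : Submodule ℂ (ℕ+ → ℂ) := ⨅ r : ℕ, weightedLpSubmodule ∞ (-(r : ℤ))

/-- The space `s` of rapidly decreasing sequences. -/
def RapidSeq : Type := rapidSubmodule

instance : AddCommGroup RapidSeq := inferInstanceAs (AddCommGroup rapidSubmodule)

instance : Module ℂ RapidSeq := inferInstanceAs (Module ℂ rapidSubmodule)

/-- The inclusion of `s` in the space of all sequences `x` with `(i ^ r * x i)_i` bounded. -/
def RapidSeq.toWeighted (r : ℕ) : RapidSeq →ₗ[ℂ] WeightedLp ∞ (-(r : ℤ)) where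
  toFun x := ⟨x.1, (Submodule.mem_iInf _).1 x.2 r⟩
  map_add' _ _ := rfl
  map_smul' _ _ := rfl

/-- The seminorms `x ↦ sup_i i ^ r * |x i|` of `s`. -/
def rapidSeminorms : SeminormFamily ℂ RapidSeq ℕ := fun r =>
  (normSeminorm ℂ (WeightedLp ∞ (-(r : ℤ)))).comp (RapidSeq.toWeighted r)

instance : TopologicalSpace RapidSeq := rapidSeminorms.moduleFilterBasis.topology

theorem withSeminorms_rapid : WithSeminorms rapidSeminorms := ⟨rfl⟩

/-! ### The two spectra of double sequence spaces -/

section Spectra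

variable (p : ℝ≥0∞) [Fact (1 ≤ p)]

/-- The completed tensor product of `s` and `(ℓ^p)_{-k}`. -/
abbrev LpStep (k : ℤ) : Type := CompletedTensor RapidSeq (WeightedLp p k)

/-- The linking map induced by the inclusion `(ℓ^p)_{-k} ⊆ (ℓ^p)_{-l}`. -/
def lpLink (k l : ℤ) (h : k ≤ l) : LpStep p k →L[ℂ] LpStep p l :=
  CompletedTensor.lTensor RapidSeq (WeightedLp.incl p h)

/-- The completed tensor product of `s` and `(c_0)_{-k}`. -/
abbrev C0Step (k : ℤ) : Type := CompletedTensor RapidSeq (WeightedC0 k)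

/-- The linking map induced by the inclusion `(c_0)_{-k} ⊆ (c_0)_{-l}`. -/
def c0Link (k l : ℤ) (h : k ≤ l) : C0Step k →L[ℂ] C0Step l :=
  CompletedTensor.lTensor RapidSeq (WeightedC0.incl h)

end Spectra

end

/-! Every step is a space of double sequences `x (i, j)`. Since `s` has the absolutely convergent
expansions `a = ∑ a i • unit i`, the completed tensor product of `s` with a Banach space `X` carries
the seminorms `sup i ^ r * ‖x i‖` (`RapidTensor.withSeminorms`). For `X` one of the weighted
sequence spaces, coordinates are at most `j ^ k` times the norm and unit vectors have norm at most
`j ^ (-k)`. These two estimates, recorded in `MatrixCoordinates`, are all that is used of `ℓ^p` or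
`c_0`: the gap between them costs a shift of the step by 2, because `∑ i ^ (-2) * j ^ (-2)`
converges.

The limit thus consists of the `x` for which a single `n` satisfies `i ^ r * ‖x (i, j)‖ ≤ C r * j ^
n` for all `r`. Its topology has an explicit description by the seminorms `∑ v a * ‖x a‖` with `v`
tempered: these are continuous on each step, and conversely a continuous seminorm `q` is dominated
by the one with `v a = q (unit a)` (`IndLim.exists_weightSeminorm_subset`).

The heart is `exists_uniform_bound_of_tempered`, a diagonal argument: a family bounded against all
tempered weights lies in one `rapidBox C n`. Such a box is compact for coordinatewise convergence
and maps continuously into step `n + 2`, which gives compact regularity. The coordinatewise limit of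
a Cauchy filter is bounded against all tempered weights, so it lies in a box and hence in a step,
which gives completeness. Continuous coordinates separate points, so the limit is Hausdorff. -/

noncomputable section

/-! ### Weights on double sequences -/

/-- The nonnegative weights `v` on double sequences such that, for every `k`, `v (i, j) * j ^ k` is
bounded by a multiple of some power of `i`. -/
def IsTemperedWeight (v : ℕ+ × ℕ+ → ℝ) : Prop :=
  (∀ a, 0 ≤ v a) ∧ ∀ k : ℕ, ∃ (r : ℕ) (C : ℝ), ∀ a : ℕ+ × ℕ+,
    v a * ((a.2 : ℕ) : ℝ) ^ k ≤ C * ((a.1 : ℕ) : ℝ) ^ r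

theorem PNat.one_le_cast_real (i : ℕ+) : (1 : ℝ) ≤ ((i : ℕ) : ℝ) := by exact_mod_cast i.pos

theorem PNat.cast_real_pos (i : ℕ+) : (0 : ℝ) < ((i : ℕ) : ℝ) := by exact_mod_cast i.pos

theorem summable_pnat_inv_sq : Summable fun i : ℕ+ => (((i : ℕ) : ℝ) ^ 2)⁻¹ :=
  (Real.summable_nat_pow_inv.2 one_lt_two).comp_injective PNat.coe_injective

theorem summable_pnat_prod_inv_sq :
    Summable fun a : ℕ+ × ℕ+ => (((a.1 : ℕ) : ℝ) ^ 2)⁻¹ * (((a.2 : ℕ) : ℝ) ^ 2)⁻¹ :=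
  summable_pnat_inv_sq.mul_of_nonneg summable_pnat_inv_sq (fun _ => by positivity)
    fun _ => by positivity

/-- On the support `j ^ k ≤ i ^ (r * k)`. Boundedness against this weight controls the region `j ≤ i
^ r`, so violations of a larger bound can only occur where `i ^ r < j`. -/
theorem isTemperedWeight_indicator_le (r : ℕ) :
    IsTemperedWeight fun a => if (a.2 : ℕ) ≤ (a.1 : ℕ) ^ r then ((a.1 : ℕ) : ℝ) ^ r else 0 := by
  refine ⟨fun a => by beta_reduce; split_ifs <;> positivity, fun k => ⟨r + r * k, 1, fun a => ?_⟩⟩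
  beta_reduce
  split_ifs with h
  · rw [one_mul, pow_add, pow_mul]
    gcongr
    exact_mod_cast h
  · rw [zero_mul]
    positivity

theorem isTemperedWeight_single (b : ℕ+ × ℕ+) :
    IsTemperedWeight fun a => if a = b then 1 else 0 := by
  refine ⟨fun a => by beta_reduce; split_ifs <;> positivity, fun k => ⟨0, ((b.2 : ℕ) : ℝ) ^ k, fun a => ?_⟩⟩
  beta_reduce
  split_ifs with h
  · simp [h]
  · rw [zero_mul]
    positivity

/-- For fixed `k`, the indices `n > k` satisfy `w n * j ^ k ≤ 1` by `h`, and finitely many indices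
remain. The points `a n` may repeat, hence the supremum; the case `k = 0` bounds it, so that the
real `⨆` is not the default value 0. -/
theorem isTemperedWeight_iSup_single (a : ℕ → ℕ+ × ℕ+) (w : ℕ → ℝ) (hw : ∀ n, 0 ≤ w n)
    (h : ∀ n, w n * (((a n).2 : ℕ) : ℝ) ^ n ≤ (((a n).2 : ℕ) : ℝ)) :
    IsTemperedWeight (fun b => ⨆ n, if b = a n then w n else 0) ∧
      ∀ m, w m ≤ ⨆ n, if a m = a n then w n else 0 := by
  have key : ∀ k : ℕ, ∃ M : ℝ, 0 ≤ M ∧ ∀ n, w n * (((a n).2 : ℕ) : ℝ) ^ k ≤ M := by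
    intro k
    refine ⟨1 + ∑ n ∈ Finset.range (k + 1), w n * (((a n).2 : ℕ) : ℝ) ^ k, ?_, fun n => ?_⟩
    · have : 0 ≤ ∑ n ∈ Finset.range (k + 1), w n * (((a n).2 : ℕ) : ℝ) ^ k :=
        Finset.sum_nonneg fun n _ => mul_nonneg (hw n) (by positivity)
      linarith
    · have hs : ∀ m, 0 ≤ w m * (((a m).2 : ℕ) : ℝ) ^ k :=
        fun m => mul_nonneg (hw m) (by positivity)
      rcases Nat.lt_or_ge k n with hn | hn
      · have h1 : w n * (((a n).2 : ℕ) : ℝ) ^ k * (((a n).2 : ℕ) : ℝ) ≤ 1 * (((a n).2 : ℕ) : ℝ) := by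
          rw [one_mul, mul_assoc, ← pow_succ]
          refine le_trans ?_ (h n)
          gcongr
          · exact hw n
          · exact PNat.one_le_cast_real _
          · omega
        have h2 := le_of_mul_le_mul_right h1 (PNat.cast_real_pos _)
        have h3 := Finset.sum_nonneg fun m (_ : m ∈ Finset.range (k + 1)) => hs m
        linarith
      · have h3 := Finset.single_le_sum (f := fun m => w m * (((a m).2 : ℕ) : ℝ) ^ k)
          (fun m _ => hs m) (Finset.mem_range.2 (Nat.lt_succ_of_le hn))
        beta_reduce at h3
        linarith
  refine ⟨⟨fun b => Real.iSup_nonneg fun n => ?_, fun k => ?_⟩, fun m => ?_⟩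
  · split_ifs
    exacts [hw n, le_rfl]
  · obtain ⟨M, hM0, hM⟩ := key k
    refine ⟨0, M, fun b => ?_⟩
    rw [pow_zero, mul_one, ← le_div_iff₀ (pow_pos (PNat.cast_real_pos _) _)]
    refine Real.iSup_le (fun n => ?_) (by positivity)
    split_ifs with hb
    · rw [hb, le_div_iff₀ (pow_pos (PNat.cast_real_pos _) _)]
      exact hM n
    · positivity
  · obtain ⟨M, hM0, hM⟩ := key 0
    refine le_trans ?_ (le_ciSup (f := fun n => if a m = a n then w n else 0) ⟨M, ?_⟩ m)
    · simp
    · rintro _ ⟨n, rfl⟩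
      beta_reduce
      split_ifs
      · simpa using hM n
      · exact hM0

/-- A family of double sequences that is bounded with respect to all tempered weights satisfies
uniform bounds `i ^ r * ‖x (i, j)‖ ≤ C r * j ^ n` for a single `n`. -/
theorem exists_uniform_bound_of_tempered {ι : Type*} (X : ι → ℕ+ × ℕ+ → ℂ)
    (h : ∀ v, IsTemperedWeight v → ∃ C : ℝ, ∀ t a, v a * ‖X t a‖ ≤ C) :
    ∃ n : ℕ, ∀ r : ℕ, ∃ C : ℝ, ∀ t a,
      ((a.1 : ℕ) : ℝ) ^ r * ‖X t a‖ ≤ C * ((a.2 : ℕ) : ℝ) ^ n := by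
  by_contra! hcon
  choose r hr using hcon
  choose B hB using fun n => h _ (isTemperedWeight_indicator_le (r n))
  -- `B n` excludes violations with `j ≤ i ^ r n`, while `n` makes the weighted values at the chosen
  -- points unbounded.
  choose t a ha using fun n : ℕ => hr n (max (B n) n)
  have hone : ∀ n, max (B n) n ≤ max (B n) (n : ℝ) * (((a n).2 : ℕ) : ℝ) ^ n := fun n =>
    le_mul_of_one_le_right (le_max_of_le_right (by positivity))
      (one_le_pow₀ (PNat.one_le_cast_real _))
  have hlt : ∀ n, ((a n).1 : ℕ) ^ r n < ((a n).2 : ℕ) := by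
    intro n
    by_contra! hle
    have h1 := hB n (t n) (a n)
    rw [if_pos hle] at h1
    have h2 := ha n
    have h3 := hone n
    have h4 := le_max_left (B n) (n : ℝ)
    linarith
  have hpos : ∀ n, 0 < (((a n).2 : ℕ) : ℝ) ^ n := fun n => pow_pos (PNat.cast_real_pos _) n
  -- With this choice the growth condition on `w` reads `i ^ r n ≤ j`, which is `hlt`, and `ha` says
  -- that the weighted value at `a n` exceeds `n`.
  obtain ⟨hv, hw⟩ := isTemperedWeight_iSup_single a
    (fun n => (((a n).1 : ℕ) : ℝ) ^ r n / (((a n).2 : ℕ) : ℝ) ^ n) (fun n => by positivity)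
    (fun n => by
      rw [div_mul_cancel₀ _ (hpos n).ne']
      exact_mod_cast (hlt n).le)
  obtain ⟨C, hC⟩ := h _ hv
  obtain ⟨m, hm⟩ := exists_nat_gt C
  have h1 := (mul_le_mul_of_nonneg_right (hw m) (norm_nonneg (X (t m) (a m)))).trans
    (hC (t m) (a m))
  rw [div_mul_eq_mul_div, div_le_iff₀ (hpos m)] at h1
  have h2 := ha m
  have h3 : (m : ℝ) * (((a m).2 : ℕ) : ℝ) ^ m ≤ max (B m) (m : ℝ) * (((a m).2 : ℕ) : ℝ) ^ m :=
    mul_le_mul_of_nonneg_right (le_max_right _ _) (hpos m).le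
  have h4 := mul_lt_mul_of_pos_right hm (hpos m)
  linarith

/-! ### Seminorms and locally convex topologies -/

section Seminorms

/-- The nonnegative complex scalars are the nonnegative reals, so convexity over `ℂ` and over `ℝ`
agree. -/
theorem locallyConvexSpace_complex (V : Type*) [AddCommGroup V] [Module ℂ V] [TopologicalSpace V]
    [LocallyConvexSpace ℝ V] : open scoped ComplexOrder in LocallyConvexSpace ℂ V := by
  open scoped ComplexOrder in
  exact (locallyConvexSpace_iff ℂ V).2 fun x =>
    (LocallyConvexSpace.convex_basis (𝕜 := ℝ) x).to_hasBasis
      (fun s hs => ⟨s, ⟨hs.1, convex_of_nonneg_surjective_algebraMap _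
        (fun _ hc => RCLike.nonneg_iff_exists_ofReal.mp hc) hs.2⟩, subset_rfl⟩)
      fun s hs => ⟨s, ⟨hs.1, hs.2.lift ℝ⟩, subset_rfl⟩

theorem polynormableSpace_complex (V : Type*) [AddCommGroup V] [Module ℂ V] [TopologicalSpace V]
    [IsTopologicalAddGroup V] [ContinuousSMul ℂ V] [LocallyConvexSpace ℝ V] :
    PolynormableSpace ℂ V := by
  open scoped ComplexOrder in
  have := locallyConvexSpace_complex V
  have : ContinuousSMul ℝ V := IsScalarTower.continuousSMul ℂ
  exact LocallyConvexSpace.toPolynormableSpace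

/-- In a locally convex space, every neighbourhood of `0` contains the open unit ball of a
continuous seminorm. -/
theorem exists_continuous_seminorm_ball_subset {V : Type*} [AddCommGroup V] [Module ℂ V]
    [TopologicalSpace V] [IsTopologicalAddGroup V] [ContinuousSMul ℂ V] [LocallyConvexSpace ℝ V]
    {U : Set V} (hU : U ∈ 𝓝 0) :
    ∃ p : Seminorm ℂ V, Continuous p ∧ ∀ x, p x < 1 → x ∈ U := by
  have := polynormableSpace_complex V
  obtain ⟨⟨s, ε⟩, hε, hs⟩ :=
    (PolynormableSpace.withSeminorms ℂ V).hasBasis_zero_ball.mem_iff.1 hU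
  refine ⟨(ε⁻¹).toNNReal • s.sup (fun p : {p : Seminorm ℂ V // Continuous p} => p.1),
    (Seminorm.continuous_finsetSup fun i _ => i.2).const_smul (_ : NNReal), fun x hx => hs ?_⟩
  rw [Seminorm.mem_ball_zero]
  rw [smul_apply, NNReal.smul_def, Real.coe_toNNReal _ (inv_pos.2 hε).le, smul_eq_mul, inv_mul_lt_one₀ hε] at hx
  exact hx

/-- The topology defined by `p` alone is one of the competitors in the `sInf`. -/
theorem continuous_seminorm_finestLocallyConvex {V : Type*} [AddCommGroup V] [Module ℂ V]
    {P : TopologicalSpace V → Prop} (p : Seminorm ℂ V)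
    (hp : P p.toSeminormedAddCommGroup.toUniformSpace.toTopologicalSpace) :
    @Continuous V ℝ (finestLocallyConvex V P) _ p := by
  let _ : SeminormedAddCommGroup V := p.toSeminormedAddCommGroup
  let _ : NormedSpace ℂ V := { norm_smul_le := fun c x => (map_smul_eq_mul p c x).le }
  exact continuous_le_dom (sInf_le ⟨⟨inferInstance, inferInstance, NormedSpace.toLocallyConvexSpace' ℂ⟩, hp⟩) (continuous_norm (E := V))

theorem continuous_toSeminormedAddCommGroup {V W : Type*} [AddCommGroup V] [Module ℂ V]
    [AddCommGroup W] [Module ℂ W] [TopologicalSpace W] [IsTopologicalAddGroup W]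
    (p : Seminorm ℂ V) (g : W →ₗ[ℂ] V) (hg : Continuous fun x => p (g x)) :
    @Continuous W V _ p.toSeminormedAddCommGroup.toUniformSpace.toTopologicalSpace g := by
  let _ : SeminormedAddCommGroup V := p.toSeminormedAddCommGroup
  refine continuous_of_continuousAt_zero g.toAddMonoidHom ?_
  rw [ContinuousAt, map_zero, tendsto_zero_iff_norm_tendsto_zero]
  exact hg.tendsto' 0 0 (by rw [map_zero, map_zero])

theorem Seminorm.sum_apply_le {V ι : Type*} [AddCommGroup V] [Module ℂ V] (p : Seminorm ℂ V)
    (s : Finset ι) (v : ι → V) : p (∑ a ∈ s, v a) ≤ ∑ a ∈ s, p (v a) :=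
  Finset.le_sum_of_subadditive p (map_zero p).le (map_add_le_add p) s v

theorem Seminorm.le_tsum_of_hasSum {V ι : Type*} [AddCommGroup V] [Module ℂ V]
    [TopologicalSpace V] {p : Seminorm ℂ V} (hp : Continuous p) {v : ι → V} {x : V}
    (hv : HasSum v x) (hs : Summable fun a => p (v a)) : p x ≤ ∑' a, p (v a) :=
  le_of_tendsto' ((hp.tendsto x).comp hv) fun s =>
    (p.sum_apply_le s v).trans (hs.sum_le_tsum s fun _ _ => apply_nonneg p _)

theorem WithSeminorms.summable {V ι κ : Type*} [AddCommGroup V] [Module ℂ V] [UniformSpace V]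
    [IsUniformAddGroup V] [CompleteSpace V] {p : SeminormFamily ℂ V κ} (hp : WithSeminorms p)
    {v : ι → V} (hv : ∀ r, Summable fun a => p r (v a)) : Summable v := by
  rw [summable_iff_cauchySeq_finset, cauchySeq_finset_iff_sum_vanishing]
  intro e he
  obtain ⟨⟨s, ε⟩, hε, hs⟩ := hp.hasBasis_zero_ball.mem_iff.1 he
  have hsum : Summable fun a => ∑ r ∈ s, p r (v a) := summable_sum fun r _ => hv r
  obtain ⟨t, ht⟩ := summable_iff_vanishing_norm.1 hsum ε hε
  refine ⟨t, fun t' htt' => hs ?_⟩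
  rw [Seminorm.mem_ball_zero]
  refine lt_of_le_of_lt ?_ (ht t' htt')
  refine ((s.sup p).sum_apply_le t' v).trans ((Finset.sum_le_sum fun a _ => ?_).trans
    (le_abs_self _))
  exact Seminorm.finset_sup_apply_le (Finset.sum_nonneg fun r _ => apply_nonneg _ _) fun r hr =>
    Finset.single_le_sum (f := fun r => p r (v a)) (fun r _ => apply_nonneg _ _) hr

end Seminorms

/-! ### Spaces of double sequences -/

/-- The double sequences `x` with `i ^ r * ‖x (i, j)‖ ≤ C r * j ^ n` for all `r`. -/
def rapidBox (C : ℕ → ℝ) (n : ℕ) : Set (ℕ+ × ℕ+ → ℂ) :=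
  {x | ∀ r a, ((a.1 : ℕ) : ℝ) ^ r * ‖x a‖ ≤ C r * ((a.2 : ℕ) : ℝ) ^ n}

/-- The case `r = 0` confines the box to a product of closed discs, where Tychonoff's theorem
applies; the remaining conditions are closed. -/
theorem isCompact_rapidBox (C : ℕ → ℝ) (n : ℕ) : IsCompact (rapidBox C n) := by
  refine (isCompact_univ_pi fun a : ℕ+ × ℕ+ =>
    isCompact_closedBall (0 : ℂ) (C 0 * ((a.2 : ℕ) : ℝ) ^ n)).of_isClosed_subset ?_ ?_
  · simp only [rapidBox, Set.ofPred_forall]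
    refine isClosed_iInter fun r => isClosed_iInter fun a => isClosed_le ?_ continuous_const
    fun_prop
  · intro x hx a _
    simpa using hx 0 a

/-- Testing temperedness with `n + 2` and the bound on `z` with `r + 2` leaves two spare powers of
`i` and `j`, which make the right-hand side summable. -/
theorem IsTemperedWeight.exists_mul_norm_le {v : ℕ+ × ℕ+ → ℝ} (hv : IsTemperedWeight v) (n : ℕ) :
    ∃ (r : ℕ) (c : ℝ), 0 ≤ c ∧ ∀ (a : ℕ+ × ℕ+) (z : ℂ) (M : ℝ),
      ((a.1 : ℕ) : ℝ) ^ (r + 2) * ‖z‖ ≤ M * ((a.2 : ℕ) : ℝ) ^ n →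
      v a * ‖z‖ ≤ c * M * ((((a.1 : ℕ) : ℝ) ^ 2)⁻¹ * (((a.2 : ℕ) : ℝ) ^ 2)⁻¹) := by
  obtain ⟨r, c, hc⟩ := hv.2 (n + 2)
  have hc0 : 0 ≤ c := (hv.1 (1, 1)).trans (by simpa using hc (1, 1))
  refine ⟨r, c, hc0, fun a z M h => ?_⟩
  have hi := PNat.cast_real_pos a.1
  have hj := PNat.cast_real_pos a.2
  have h1 := hc a
  generalize ((a.1 : ℕ) : ℝ) = i at *
  generalize ((a.2 : ℕ) : ℝ) = j at *
  rw [← mul_inv, ← div_eq_mul_inv, le_div_iff₀ (by positivity)]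
  have hpos : 0 < j ^ n := by positivity
  refine le_of_mul_le_mul_right ?_ hpos
  calc v a * ‖z‖ * (i ^ 2 * j ^ 2) * j ^ n = (v a * j ^ (n + 2)) * (i ^ 2 * ‖z‖) := by ring
    _ ≤ (c * i ^ r) * (i ^ 2 * ‖z‖) := by gcongr
    _ = c * (i ^ (r + 2) * ‖z‖) := by ring
    _ ≤ c * (M * j ^ n) := by gcongr
    _ = c * M * j ^ n := by ring

theorem IsTemperedWeight.summable {v : ℕ+ × ℕ+ → ℝ} (hv : IsTemperedWeight v) {C : ℕ → ℝ} {n : ℕ}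
    {x : ℕ+ × ℕ+ → ℂ} (hx : x ∈ rapidBox C n) : Summable fun a => v a * ‖x a‖ := by
  obtain ⟨r, c, -, h⟩ := hv.exists_mul_norm_le n
  exact (summable_pnat_prod_inv_sq.mul_left (c * C (r + 2))).of_nonneg_of_le
    (fun a => mul_nonneg (hv.1 a) (norm_nonneg _)) fun a => h a _ _ (hx (r + 2) a)

/-- A realization of `V` as a space of double sequences `x`, with topology given by seminorms that
behave like `sup i ^ r * j ^ (-k) * ‖x (i, j)‖` on the coordinates and the unit vectors. -/
structure MatrixCoordinates (k : ℤ) (V : Type*) [AddCommGroup V] [Module ℂ V] [UniformSpace V] where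
  seminorm : SeminormFamily ℂ V ℕ
  withSeminorms : WithSeminorms seminorm
  coord : V →ₗ[ℂ] (ℕ+ × ℕ+ → ℂ)
  unit : ℕ+ × ℕ+ → V
  coord_injective : Function.Injective coord
  coord_unit : ∀ a b, coord (unit a) b = if b = a then 1 else 0
  coord_le : ∀ r x a,
    ((a.1 : ℕ) : ℝ) ^ r * ‖coord x a‖ ≤ ((a.2 : ℕ) : ℝ) ^ k * seminorm r x
  seminorm_unit_le : ∀ r a, seminorm r (unit a) ≤ ((a.1 : ℕ) : ℝ) ^ r * ((a.2 : ℕ) : ℝ) ^ (-k)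

namespace MatrixCoordinates

variable {k : ℤ} {V : Type*} [AddCommGroup V] [Module ℂ V] [UniformSpace V]
  (D : MatrixCoordinates k V)

theorem continuous_coord (a : ℕ+ × ℕ+) : Continuous fun x => D.coord x a := by
  refine D.withSeminorms.continuous_normedSpace_rng ℂ
    ((LinearMap.proj a : (ℕ+ × ℕ+ → ℂ) →ₗ[ℂ] ℂ).comp D.coord)
    ⟨{0}, ((a.2 : ℕ) : NNReal) ^ k, fun x => ?_⟩
  simpa [NNReal.smul_def] using D.coord_le 0 x a

theorem isFrechetSpace [IsUniformAddGroup V] [CompleteSpace V] (D : MatrixCoordinates k V) : IsFrechetSpace V := by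
  have := D.withSeminorms.firstCountableTopology
  have : T1Space V := by
    refine D.withSeminorms.T1_of_separating fun x hx => ?_
    by_contra! h
    refine hx (D.coord_injective (funext fun a => ?_))
    have := D.coord_le 0 x a
    rw [h 0] at this
    simpa using this
  have : (uniformity V).IsCountablyGenerated := IsUniformAddGroup.uniformity_countably_generated
  exact ⟨inferInstance, D.withSeminorms.continuousSMul, D.withSeminorms.toLocallyConvexSpace,
    UniformSpace.metrizableSpace, inferInstance⟩

theorem exists_seminorm_unit_le {p : Seminorm ℂ V} (hp : Continuous p) :
    ∃ (r : ℕ) (C : ℝ), ∀ a, p (D.unit a) ≤ C * (((a.1 : ℕ) : ℝ) ^ r * ((a.2 : ℕ) : ℝ) ^ (-k)) := by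
  obtain ⟨s, C, -, h⟩ := Seminorm.bound_of_continuous D.withSeminorms p hp
  refine ⟨s.sup id, C, fun a => (h _).trans ?_⟩
  rw [smul_apply, NNReal.smul_def, smul_eq_mul]
  gcongr
  refine Seminorm.finset_sup_apply_le (by positivity) fun r hr => (D.seminorm_unit_le r a).trans ?_
  gcongr
  · exact PNat.one_le_cast_real _
  · exact Finset.le_sup (f := id) hr

end MatrixCoordinates

/-! ### Recovering a vector from its coordinates, two steps later -/

namespace MatrixCoordinates

variable {n : ℕ} {V : Type*} [AddCommGroup V] [Module ℂ V] [UniformSpace V]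

theorem coord_mem_rapidBox (D : MatrixCoordinates (n : ℤ) V) (x : V) :
    D.coord x ∈ rapidBox (fun r => D.seminorm r x) n := fun r a => by
  have := D.coord_le r x a
  rwa [zpow_natCast, mul_comm (_ ^ n)] at this

variable (D : MatrixCoordinates ((n + 2 : ℕ) : ℤ) V)

/-- The unit vector contributes `j ^ (-(n + 2))`, of which `j ^ (-2)` survives the growth `j ^ n`;
the factor `i ^ (-2)` comes from using the bound of order `r + 2`. -/
theorem seminorm_smul_unit_le (r : ℕ) (a : ℕ+ × ℕ+) (z : ℂ) (M : ℝ)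
    (h : ((a.1 : ℕ) : ℝ) ^ (r + 2) * ‖z‖ ≤ M * ((a.2 : ℕ) : ℝ) ^ n) :
    D.seminorm r (z • D.unit a) ≤
      M * ((((a.1 : ℕ) : ℝ) ^ 2)⁻¹ * (((a.2 : ℕ) : ℝ) ^ 2)⁻¹) := by
  have h1 := D.seminorm_unit_le r a
  rw [map_smul_eq_mul]
  have hi := PNat.cast_real_pos a.1
  have hj := PNat.cast_real_pos a.2
  rw [zpow_neg, zpow_natCast] at h1
  refine (mul_le_mul_of_nonneg_left h1 (norm_nonneg z)).trans ?_
  generalize ((a.1 : ℕ) : ℝ) = i at *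
  generalize ((a.2 : ℕ) : ℝ) = j at *
  rw [← mul_inv, ← div_eq_mul_inv, ← div_eq_mul_inv, le_div_iff₀ (by positivity), mul_div_assoc',
    div_mul_eq_mul_div, div_le_iff₀ (by positivity)]
  calc ‖z‖ * i ^ r * (i ^ 2 * j ^ 2) = (i ^ (r + 2) * ‖z‖) * j ^ 2 := by ring
    _ ≤ M * j ^ n * j ^ 2 := by gcongr
    _ = M * j ^ (n + 2) := by ring

variable [IsUniformAddGroup V] [CompleteSpace V]

theorem summable_smul_unit {C : ℕ → ℝ} {x : ℕ+ × ℕ+ → ℂ} (hx : x ∈ rapidBox C n) :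
    Summable fun a => x a • D.unit a :=
  D.withSeminorms.summable fun r =>
    (summable_pnat_prod_inv_sq.mul_left (C (r + 2))).of_nonneg_of_le (fun _ => apply_nonneg _ _)
      fun a => D.seminorm_smul_unit_le r a _ _ (hx (r + 2) a)

theorem coord_eq_of_hasSum {x : ℕ+ × ℕ+ → ℂ} {y : V} (h : HasSum (fun a => x a • D.unit a) y) :
    D.coord y = x := by
  have := D.isFrechetSpace
  funext b
  have h1 : HasSum (fun a => D.coord (x a • D.unit a) b) (D.coord y b) :=
    h.map (((LinearMap.proj b : (ℕ+ × ℕ+ → ℂ) →ₗ[ℂ] ℂ).comp D.coord)) (D.continuous_coord b)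
  refine h1.unique ?_
  convert hasSum_ite_eq b (x b) using 2 with a
  rw [map_smul, Pi.smul_apply, D.coord_unit, smul_eq_mul]
  split_ifs with h1 h2 h2
  · rw [h1, mul_one]
  · exact absurd h1.symm h2
  · exact absurd h2.symm h1
  · rw [mul_zero]

/-- The element with the given coordinates. -/
def ofCoord (x : ℕ+ × ℕ+ → ℂ) : V := ∑' a, x a • D.unit a

theorem coord_ofCoord {C : ℕ → ℝ} {x : ℕ+ × ℕ+ → ℂ} (hx : x ∈ rapidBox C n) :
    D.coord (D.ofCoord x) = x :=
  D.coord_eq_of_hasSum (D.summable_smul_unit hx).hasSum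

/-- On a box the terms of `∑ seminorm r ((y a - x a) • unit a)` have a summable majorant independent
of `y`. The sum is therefore continuous in `y` for coordinatewise convergence, and it vanishes at `y
= x`. -/
theorem continuousOn_ofCoord (C : ℕ → ℝ) : ContinuousOn D.ofCoord (rapidBox C n) := by
  have hF := D.isFrechetSpace
  have := hF.continuousSMul
  have := hF.metrizable
  intro x hx
  rw [ContinuousWithinAt, D.withSeminorms.tendsto_nhds _ _]
  intro r ε hε
  have hmem : ∀ y ∈ rapidBox C n, ∀ a, D.seminorm r ((y a - x a) • D.unit a) ≤
      (2 * C (r + 2)) * ((((a.1 : ℕ) : ℝ) ^ 2)⁻¹ * (((a.2 : ℕ) : ℝ) ^ 2)⁻¹) := by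
    intro y hy a
    refine D.seminorm_smul_unit_le r a _ _ ?_
    have h1 := hx (r + 2) a
    have h2 := hy (r + 2) a
    have h3 : ((a.1 : ℕ) : ℝ) ^ (r + 2) * ‖y a - x a‖ ≤
        ((a.1 : ℕ) : ℝ) ^ (r + 2) * (‖y a‖ + ‖x a‖) := by
      gcongr
      exact norm_sub_le _ _
    linarith
  have hsum := summable_pnat_prod_inv_sq.mul_left (2 * C (r + 2))
  have hcont : ContinuousOn (fun y : ℕ+ × ℕ+ → ℂ =>
      ∑' a, D.seminorm r ((y a - x a) • D.unit a)) (rapidBox C n) := by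
    refine continuousOn_tsum (fun a => ?_) hsum fun a y hy => ?_
    · refine Continuous.continuousOn ?_
      simp only [map_smul_eq_mul]
      fun_prop
    · rw [Real.norm_of_nonneg (apply_nonneg _ _)]
      exact hmem y hy a
  have hev := (hcont x hx).eventually_lt_const (u := ε) (by simpa using hε)
  filter_upwards [hev, self_mem_nhdsWithin] with y hy hyC
  refine lt_of_le_of_lt ?_ hy
  refine Seminorm.le_tsum_of_hasSum (D.withSeminorms.continuous_seminorm r) ?_
    (hsum.of_nonneg_of_le (fun _ => apply_nonneg _ _) (hmem y hyC))
  simp only [sub_smul]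
  exact (D.summable_smul_unit hyC).hasSum.sub (D.summable_smul_unit hx).hasSum

end MatrixCoordinates

/-! ### Inductive limits of spaces of double sequences -/

section InductiveLimitOfMatrices

variable {E : ℤ → Type*} [∀ k, AddCommGroup (E k)] [∀ k, Module ℂ (E k)]
  [∀ k, UniformSpace (E k)] {f : ∀ k l : ℤ, k ≤ l → E k →L[ℂ] E l}

theorem IndLim.of_apply {k l : ℤ} (h : k ≤ l) (x : E k) :
    IndLim.of E f l (f k l h x) = IndLim.of E f k x :=
  Module.DirectLimit.of_f

theorem IndLim.exists_of (x : IndLim E f) : ∃ k y, IndLim.of E f k y = x :=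
  Module.DirectLimit.exists_of x

theorem IndLim.continuous_of (k : ℤ) : Continuous (IndLim.of E f k) :=
  continuous_sInf_rng.2 fun _ ht => ht.2 k

theorem IndLim.continuous_seminorm [∀ k, IsUniformAddGroup (E k)] (p : Seminorm ℂ (IndLim E f))
    (hp : ∀ k, Continuous fun x : E k => p (IndLim.of E f k x)) : Continuous p :=
  continuous_seminorm_finestLocallyConvex p fun k =>
    continuous_toSeminormedAddCommGroup p (IndLim.of E f k) (hp k)

variable (D : ∀ k, MatrixCoordinates k (E k))
  (hf : ∀ k l h x, (D l).coord (f k l h x) = (D k).coord x)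

/-- The coordinates on the inductive limit. -/
def IndLim.coord : IndLim E f →ₗ[ℂ] (ℕ+ × ℕ+ → ℂ) :=
  Module.DirectLimit.lift ℂ ℤ E (fun k l h => (f k l h).toLinearMap) (fun k => (D k).coord) hf

theorem IndLim.coord_of (k : ℤ) (x : E k) :
    IndLim.coord D hf (IndLim.of E f k x) = (D k).coord x :=
  Module.DirectLimit.lift_of _ _ x

theorem IndLim.coord_injective : Function.Injective (IndLim.coord D hf) := by
  rw [← LinearMap.ker_eq_bot, LinearMap.ker_eq_bot']
  intro x hx
  obtain ⟨k, y, rfl⟩ := IndLim.exists_of x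
  rw [IndLim.coord_of] at hx
  rw [(D k).coord_injective (hx.trans (map_zero (D k).coord).symm), map_zero]

theorem IndLim.exists_of_natCast (x : IndLim E f) :
    ∃ (n : ℕ) (y : E n), IndLim.of E f n y = x := by
  obtain ⟨k, y, rfl⟩ := IndLim.exists_of x
  exact ⟨k.toNat, f k _ (Int.self_le_toNat k) y, IndLim.of_apply _ _⟩

theorem IndLim.exists_coord_mem_rapidBox (x : IndLim E f) :
    ∃ C n, IndLim.coord D hf x ∈ rapidBox C n := by
  obtain ⟨n, y, rfl⟩ := IndLim.exists_of_natCast x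
  rw [IndLim.coord_of]
  exact ⟨_, n, (D n).coord_mem_rapidBox y⟩

/-- Whatever step `x` came from, the growth of its coordinates alone places it in step `n + 2`. -/
theorem IndLim.of_ofCoord [∀ k, IsUniformAddGroup (E k)] [∀ k, CompleteSpace (E k)]
    {C : ℕ → ℝ} {n : ℕ} {x : IndLim E f} (hx : IndLim.coord D hf x ∈ rapidBox C n) :
    IndLim.of E f ((n + 2 : ℕ) : ℤ) ((D ((n + 2 : ℕ) : ℤ)).ofCoord (IndLim.coord D hf x)) = x :=
  IndLim.coord_injective D hf (by
    rw [IndLim.coord_of, MatrixCoordinates.coord_ofCoord _ hx])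

theorem IndLim.of_unit (hf : ∀ k l h x, (D l).coord (f k l h x) = (D k).coord x)
    (k l : ℤ) (a : ℕ+ × ℕ+) :
    IndLim.of E f k ((D k).unit a) = IndLim.of E f l ((D l).unit a) := by
  refine IndLim.coord_injective D hf (funext fun b => ?_)
  rw [IndLim.coord_of, IndLim.coord_of, MatrixCoordinates.coord_unit,
    MatrixCoordinates.coord_unit]

theorem IndLim.summable_weight {v : ℕ+ × ℕ+ → ℝ} (hv : IsTemperedWeight v) (x : IndLim E f) :
    Summable fun a => v a * ‖IndLim.coord D hf x a‖ := by
  obtain ⟨C, n, hx⟩ := IndLim.exists_coord_mem_rapidBox D hf x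
  exact hv.summable hx

/-- The seminorm `x ↦ ∑ v (i, j) * ‖x (i, j)‖` on the inductive limit. -/
def IndLim.weightSeminorm {v : ℕ+ × ℕ+ → ℝ} (hv : IsTemperedWeight v) :
    Seminorm ℂ (IndLim E f) :=
  Seminorm.of (fun x => ∑' a, v a * ‖IndLim.coord D hf x a‖)
    (fun x y => by
      rw [← (IndLim.summable_weight D hf hv x).tsum_add (IndLim.summable_weight D hf hv y)]
      refine (IndLim.summable_weight D hf hv (x + y)).tsum_le_tsum (fun a => ?_)
        ((IndLim.summable_weight D hf hv x).add (IndLim.summable_weight D hf hv y))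
      rw [map_add, ← mul_add]
      exact mul_le_mul_of_nonneg_left (norm_add_le _ _) (hv.1 a))
    (fun c x => by
      rw [← tsum_mul_left]
      refine tsum_congr fun a => ?_
      rw [map_smul, Pi.smul_apply, norm_smul, mul_left_comm])

theorem IndLim.weightSeminorm_apply {v : ℕ+ × ℕ+ → ℝ} (hv : IsTemperedWeight v) (x : IndLim E f) :
    IndLim.weightSeminorm D hf hv x = ∑' a, v a * ‖IndLim.coord D hf x a‖ := rfl

theorem IndLim.mul_norm_coord_le {v : ℕ+ × ℕ+ → ℝ} (hv : IsTemperedWeight v) (x : IndLim E f)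
    (a : ℕ+ × ℕ+) : v a * ‖IndLim.coord D hf x a‖ ≤ IndLim.weightSeminorm D hf hv x :=
  (IndLim.summable_weight D hf hv x).le_tsum a fun b _ => mul_nonneg (hv.1 b) (norm_nonneg _)

/-! ### The topology of the inductive limit in terms of weights -/

variable [∀ k, IsUniformAddGroup (E k)]

/-- It suffices to check the steps. On step `n` the weighted sum is at most `c * S` times the
seminorm of order `r + 2`; a step of negative index maps to step 0. -/
theorem IndLim.continuous_weightSeminorm {v : ℕ+ × ℕ+ → ℝ} (hv : IsTemperedWeight v) :
    Continuous (IndLim.weightSeminorm D hf hv) := by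
  have key : ∀ n : ℕ, Continuous fun x : E n =>
      IndLim.weightSeminorm D hf hv (IndLim.of E f n x) := by
    intro n
    obtain ⟨r, c, hc, h⟩ := hv.exists_mul_norm_le n
    set S := ∑' a : ℕ+ × ℕ+, (((a.1 : ℕ) : ℝ) ^ 2)⁻¹ * (((a.2 : ℕ) : ℝ) ^ 2)⁻¹
    have hS : 0 ≤ S := tsum_nonneg fun _ => by positivity
    refine Seminorm.continuous_of_le
      (p := (IndLim.weightSeminorm D hf hv).comp (IndLim.of E f n))
      (q := (c * S).toNNReal • (D n).seminorm (r + 2))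
      (((D n).withSeminorms.continuous_seminorm (r + 2)).const_smul ((c * S).toNNReal))
      fun x => ?_
    rw [smul_apply, NNReal.smul_def, Real.coe_toNNReal _ (mul_nonneg hc hS),
      Seminorm.comp_apply, IndLim.weightSeminorm_apply, smul_eq_mul, mul_right_comm,
      ← tsum_mul_left]
    refine (IndLim.summable_weight D hf hv _).tsum_le_tsum (fun a => ?_)
      (summable_pnat_prod_inv_sq.mul_left _)
    rw [IndLim.coord_of]
    exact h a _ _ ((D n).coord_mem_rapidBox x (r + 2) a)
  refine IndLim.continuous_seminorm _ fun k => ?_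
  have h := (key k.toNat).comp (f k _ (Int.self_le_toNat k)).continuous
  refine h.congr fun x => ?_
  rw [Function.comp_apply, IndLim.of_apply]

theorem IndLim.continuous_coord (a : ℕ+ × ℕ+) : Continuous fun x => IndLim.coord D hf x a := by
  refine continuous_of_continuousAt_zero (((LinearMap.proj a : (ℕ+ × ℕ+ → ℂ) →ₗ[ℂ] ℂ).comp
    (IndLim.coord D hf)).toAddMonoidHom) ?_
  rw [ContinuousAt, map_zero]
  refine squeeze_zero_norm (a := IndLim.weightSeminorm D hf (isTemperedWeight_single a))
    (fun x => ?_) ((IndLim.continuous_weightSeminorm D hf _).tendsto' 0 0 (map_zero _))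
  simpa using IndLim.mul_norm_coord_le D hf (isTemperedWeight_single a) x a

theorem IndLim.t2Space (D : ∀ k, MatrixCoordinates k (E k))
    (hf : ∀ k l h x, (D l).coord (f k l h x) = (D k).coord x) : T2Space (IndLim E f) :=
  T2Space.of_injective_continuous (IndLim.coord_injective D hf)
    (continuous_pi (IndLim.continuous_coord D hf))

variable [∀ k, CompleteSpace (E k)]

/-- The weight is `v a = q (unit a)`: continuity of `q` on step `k` gives `v a ≤ C * i ^ r * j ^
(-k)`, and this for every `k` is temperedness. Expanding `x` in unit vectors in a suitable step
gives `q x ≤ ∑ v a * ‖x a‖`. -/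
theorem IndLim.exists_weightSeminorm_subset {U : Set (IndLim E f)} (hU : U ∈ 𝓝 0) :
    ∃ (v : ℕ+ × ℕ+ → ℝ) (hv : IsTemperedWeight v),
      ∀ x, IndLim.weightSeminorm D hf hv x < 1 → x ∈ U := by
  obtain ⟨q, hq, hqU⟩ := exists_continuous_seminorm_ball_subset hU
  have hv : IsTemperedWeight fun a => q (IndLim.of E f 0 ((D 0).unit a)) := by
    refine ⟨fun a => apply_nonneg q _, fun k => ?_⟩
    obtain ⟨r, C, h⟩ := (D k).exists_seminorm_unit_le (p := q.comp (IndLim.of E f k))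
      (hq.comp (IndLim.continuous_of (k : ℤ)))
    refine ⟨r, C, fun a => ?_⟩
    have ha := h a
    rw [Seminorm.comp_apply, zpow_neg, zpow_natCast, ← mul_assoc, ← div_eq_mul_inv,
      le_div_iff₀ (pow_pos (PNat.cast_real_pos _) _), IndLim.of_unit D hf k 0] at ha
    exact ha
  refine ⟨_, hv, fun x hx => hqU x (lt_of_le_of_lt ?_ hx)⟩
  obtain ⟨C, n, hC⟩ := IndLim.exists_coord_mem_rapidBox D hf x
  have h1 := ((D ((n + 2 : ℕ) : ℤ)).summable_smul_unit hC).hasSum.map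
    (IndLim.of E f ((n + 2 : ℕ) : ℤ)) (IndLim.continuous_of _)
  have h2 : ∀ a, q (IndLim.of E f ((n + 2 : ℕ) : ℤ)
      (IndLim.coord D hf x a • (D ((n + 2 : ℕ) : ℤ)).unit a)) =
      q (IndLim.of E f 0 ((D 0).unit a)) * ‖IndLim.coord D hf x a‖ := by
    intro a
    rw [map_smul, map_smul_eq_mul, mul_comm, IndLim.of_unit D hf _ 0]
  have h3 : IndLim.of E f ((n + 2 : ℕ) : ℤ) (∑' a, IndLim.coord D hf x a •
      (D ((n + 2 : ℕ) : ℤ)).unit a) = x := IndLim.of_ofCoord D hf hC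
  rw [h3] at h1
  refine (Seminorm.le_tsum_of_hasSum hq h1 ?_).trans_eq ?_
  · exact (IndLim.summable_weight D hf hv x).congr fun a => (h2 a).symm
  · exact tsum_congr h2

theorem IndLim.completeSpace (D : ∀ k, MatrixCoordinates k (E k))
    (hf : ∀ k l h x, (D l).coord (f k l h x) = (D k).coord x) : CompleteSpace (IndLim E f) := by
  have hct := IndLim.continuous_coord D hf
  refine ⟨fun {F} hF => ?_⟩
  have := hF.1
  have hsmall : ∀ v (hv : IsTemperedWeight v), ∃ A ∈ F, ∀ x ∈ A, ∀ y ∈ A,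
      IndLim.weightSeminorm D hf hv (x - y) < 1 := by
    intro v hv
    have hU : {x : IndLim E f | IndLim.weightSeminorm D hf hv x < 1} ∈ 𝓝 0 :=
      ((IndLim.continuous_weightSeminorm D hf hv).tendsto' 0 0 (map_zero _)).eventually_lt_const
        one_pos
    obtain ⟨A, hA, h⟩ := (cauchy_iff.1 hF).2 {z | z.1 - z.2 ∈ _}
      (by
        rw [uniformity_eq_comap_nhds_zero_swapped]
        exact Filter.preimage_mem_comap hU)
    exact ⟨A, hA, fun x hx y hy => h (Set.mk_mem_prod hx hy)⟩
  have hcauchy : ∀ a, ∃ z : ℂ, Filter.Tendsto (fun x => IndLim.coord D hf x a) F (𝓝 z) := by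
    intro a
    have hu : UniformContinuous fun x => IndLim.coord D hf x a :=
      uniformContinuous_addMonoidHom_of_continuous
        (f := ((LinearMap.proj a : (ℕ+ × ℕ+ → ℂ) →ₗ[ℂ] ℂ).comp
          (IndLim.coord D hf)).toAddMonoidHom) (hct a)
    exact cauchy_map_iff_exists_tendsto.1 (hF.map hu)
  choose z hz using hcauchy
  -- As in Fatou's lemma, finite partial sums allow `y` to tend to `z` coordinatewise.
  have hle : ∀ v (hv : IsTemperedWeight v), ∀ A ∈ F, (∀ x ∈ A, ∀ y ∈ A,
      IndLim.weightSeminorm D hf hv (x - y) < 1) → ∀ x ∈ A, ∀ s : Finset (ℕ+ × ℕ+),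
      ∑ a ∈ s, v a * ‖IndLim.coord D hf x a - z a‖ ≤ 1 := by
    intro v hv A hA h x hx s
    refine le_of_tendsto (f := fun y => ∑ a ∈ s, v a * ‖IndLim.coord D hf x a -
      IndLim.coord D hf y a‖) (tendsto_finsetSum _ fun a _ =>
        ((tendsto_const_nhds.sub (hz a)).norm.const_mul _)) ?_
    filter_upwards [hA] with y hy
    refine le_trans ?_ (h x hx y hy).le
    have hs := (IndLim.summable_weight D hf hv (x - y)).sum_le_tsum s
      fun b _ => mul_nonneg (hv.1 b) (norm_nonneg _)
    simpa only [IndLim.weightSeminorm_apply, map_sub, Pi.sub_apply] using hs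
  obtain ⟨n, hn⟩ := exists_uniform_bound_of_tempered (fun _ : Unit => z) fun v hv => by
    obtain ⟨A, hA, h⟩ := hsmall v hv
    obtain ⟨x, hx⟩ := hF.1.nonempty_of_mem hA
    refine ⟨IndLim.weightSeminorm D hf hv x + 1, fun _ a => ?_⟩
    have h1 := hle v hv A hA h x hx {a}
    rw [Finset.sum_singleton] at h1
    have h2 := IndLim.mul_norm_coord_le D hf hv x a
    have h3 : v a * ‖z a‖ ≤ v a * (‖IndLim.coord D hf x a‖ + ‖IndLim.coord D hf x a - z a‖) :=
      mul_le_mul_of_nonneg_left (norm_le_norm_add_norm_sub _ _) (hv.1 a)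
    linarith
  choose C hC using hn
  have hzC : z ∈ rapidBox C n := fun r a => hC r () a
  set w : IndLim E f := IndLim.of E f ((n + 2 : ℕ) : ℤ) ((D ((n + 2 : ℕ) : ℤ)).ofCoord z) with hw
  have hwz : IndLim.coord D hf w = z := by
    rw [hw, IndLim.coord_of, MatrixCoordinates.coord_ofCoord _ hzC]
  refine ⟨w, fun U hU => ?_⟩
  have hU0 : (fun x => w + x) ⁻¹' U ∈ 𝓝 (0 : IndLim E f) :=
    (continuous_const_add w).tendsto' 0 w (add_zero w) hU
  obtain ⟨v, hv, hvU⟩ := IndLim.exists_weightSeminorm_subset D hf hU0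
  -- The limit only preserves `≤ 1`; doubling the weight yields `≤ 1 / 2`, hence the strict
  -- inequality.
  have hv2 : IsTemperedWeight fun a => 2 * v a := by
    refine ⟨fun a => mul_nonneg two_pos.le (hv.1 a), fun k => ?_⟩
    obtain ⟨r, C, h⟩ := hv.2 k
    exact ⟨r, 2 * C, fun a => by linarith [h a]⟩
  obtain ⟨A, hA, h⟩ := hsmall _ hv2
  refine Filter.mem_of_superset hA fun x hx => ?_
  suffices h' : IndLim.weightSeminorm D hf hv (x - w) < 1 by
    have := hvU _ h'
    rwa [Set.mem_preimage, add_sub_cancel] at this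
  refine lt_of_le_of_lt (b := 1 / 2) ?_ (by norm_num)
  refine (IndLim.summable_weight D hf hv (x - w)).tsum_le_of_sum_le fun s => ?_
  have h1 := hle _ hv2 A hA h x hx s
  simp only [mul_assoc, ← Finset.mul_sum] at h1
  simp only [map_sub, Pi.sub_apply, hwz]
  linarith

theorem IndLim.isCompactlyRegular (D : ∀ k, MatrixCoordinates k (E k))
    (hf : ∀ k l h x, (D l).coord (f k l h x) = (D k).coord x) : IsCompactlyRegular E f := by
  have := IndLim.t2Space D hf
  intro K hK
  obtain ⟨n, hn⟩ := exists_uniform_bound_of_tempered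
    (fun (t : K) => IndLim.coord D hf t) fun v hv => by
      obtain ⟨C, hC⟩ := hK.bddAbove_image (IndLim.continuous_weightSeminorm D hf hv).continuousOn
      exact ⟨C, fun t a => (IndLim.mul_norm_coord_le D hf hv t a).trans
        (hC (Set.mem_image_of_mem _ t.2))⟩
  choose C hC using hn
  have hKC : ∀ x ∈ K, IndLim.coord D hf x ∈ rapidBox C n := fun x hx r a => hC r ⟨x, hx⟩ a
  refine ⟨((n + 2 : ℕ) : ℤ), fun x hx => ⟨_, IndLim.of_ofCoord D hf (hKC x hx)⟩, ?_⟩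
  -- The preimage of `K` is closed and lies in the image of the compact box under `ofCoord`.
  refine ((isCompact_rapidBox C n).image_of_continuousOn
    ((D ((n + 2 : ℕ) : ℤ)).continuousOn_ofCoord C)).of_isClosed_subset
    (hK.isClosed.preimage (IndLim.continuous_of _)) fun y hy => ?_
  have hyC := hKC _ hy
  rw [IndLim.coord_of] at hyC
  exact ⟨_, hyC, (D ((n + 2 : ℕ) : ℤ)).coord_injective (MatrixCoordinates.coord_ofCoord _ hyC)⟩

theorem IndLim.isLFSpace (D : ∀ k, MatrixCoordinates k (E k))
    (hf : ∀ k l h x, (D l).coord (f k l h x) = (D k).coord x) : IsLFSpace E f where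
  frechet k := (D k).isFrechetSpace
  map_self k x := (D k).coord_injective (hf _ _ _ _)
  map_map k l m hkl hlm x := (D m).coord_injective (by rw [hf, hf, hf])
  injective k l h x y hxy := (D k).coord_injective (by rw [← hf k l h, hxy, hf])
  hausdorff := IndLim.t2Space D hf

end InductiveLimitOfMatrices

/-! ### Rapidly decreasing sequences -/

namespace RapidSeq

theorem norm_weight_neg (r : ℕ) (x : ℕ+ → ℂ) (i : ℕ+) :
    ‖weight (-(r : ℤ)) x i‖ = ((i : ℕ) : ℝ) ^ r * ‖x i‖ := by
  simp [weight]

theorem pow_mul_norm_le (r : ℕ) (a : RapidSeq) (i : ℕ+) :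
    ((i : ℕ) : ℝ) ^ r * ‖a.1 i‖ ≤ rapidSeminorms r a := by
  rw [← norm_weight_neg]
  exact lp.norm_apply_le_norm ENNReal.top_ne_zero
    (WeightedLp.toLp ∞ (-(r : ℤ)) (toWeighted r a)) i

theorem rapidSeminorms_le {r : ℕ} {a : RapidSeq} {M : ℝ} (hM : 0 ≤ M)
    (h : ∀ i : ℕ+, ((i : ℕ) : ℝ) ^ r * ‖a.1 i‖ ≤ M) : rapidSeminorms r a ≤ M :=
  lp.norm_le_of_forall_le (f := WeightedLp.toLp ∞ (-(r : ℤ)) (toWeighted r a)) hM fun i => by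
    refine le_of_eq_of_le ?_ (h i)
    exact norm_weight_neg r a.1 i

/-- The unit vectors of the space of rapidly decreasing sequences. -/
def unit (i : ℕ+) : RapidSeq :=
  ⟨Pi.single i 1, (Submodule.mem_iInf _).2 fun r => memℓp_infty ⟨((i : ℕ) : ℝ) ^ r, by
    rintro _ ⟨j, rfl⟩
    beta_reduce
    rw [norm_weight_neg]
    by_cases h : j = i
    · subst h
      simp
    · simp [Pi.single_eq_of_ne h]⟩⟩

theorem unit_apply (i j : ℕ+) : (unit i).1 j = if j = i then 1 else 0 :=
  Pi.single_apply i 1 j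

theorem rapidSeminorms_unit_le (r : ℕ) (i : ℕ+) :
    rapidSeminorms r (unit i) ≤ ((i : ℕ) : ℝ) ^ r :=
  rapidSeminorms_le (by positivity) fun j => by
    rw [unit_apply]
    split_ifs with h
    · simp [h]
    · simp

instance : IsTopologicalAddGroup RapidSeq := withSeminorms_rapid.topologicalAddGroup

/-- The coordinate functionals on the space of rapidly decreasing sequences. -/
def apply (i : ℕ+) : RapidSeq →ₗ[ℂ] ℂ := (LinearMap.proj i).comp rapidSubmodule.subtype

theorem hasSum_unit (a : RapidSeq) : HasSum (fun i => a.1 i • unit i) a := by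
  refine (withSeminorms_rapid.tendsto_nhds _ _).2 fun r ε hε => ?_
  -- One spare power of `i` makes the tail beyond `N` at most `rapidSeminorms (r + 1) a / N`.
  obtain ⟨N, hN⟩ := exists_nat_gt (rapidSeminorms (r + 1) a / (ε / 2))
  rw [div_lt_iff₀ (by positivity)] at hN
  have hfin : {i : ℕ+ | (i : ℕ) < N}.Finite :=
    (Set.finite_Iio N).preimage PNat.coe_injective.injOn
  filter_upwards [Filter.eventually_ge_atTop hfin.toFinset] with s hs
  refine lt_of_le_of_lt (rapidSeminorms_le (M := ε / 2) (by positivity) fun i => ?_)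
    (half_lt_self hε)
  have hcoord : (∑ j ∈ s, a.1 j • unit j - a : RapidSeq).1 i = if i ∈ s then 0 else - a.1 i := by
    change apply i (∑ j ∈ s, a.1 j • unit j - a) = _
    rw [map_sub, map_sum]
    have h1 : ∀ j ∈ s, apply i (a.1 j • unit j) = if i = j then a.1 j else 0 := by
      intro j _
      rw [map_smul]
      change a.1 j • (unit j).1 i = _
      rw [unit_apply]
      split_ifs <;> simp
    rw [Finset.sum_congr rfl h1, Finset.sum_ite_eq]
    change _ - a.1 i = _
    split_ifs <;> simp
  rw [hcoord]
  split_ifs with h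
  · simpa using (half_pos hε).le
  · have hi : N ≤ (i : ℕ) := by
      by_contra! hlt
      exact h (hs (hfin.mem_toFinset.2 hlt))
    rw [norm_neg]
    have h1 := pow_mul_norm_le (r + 1) a i
    have hpos := PNat.cast_real_pos i
    have hi' : (N : ℝ) ≤ ((i : ℕ) : ℝ) := by exact_mod_cast hi
    refine le_of_mul_le_mul_right ?_ hpos
    calc ((i : ℕ) : ℝ) ^ r * ‖a.1 i‖ * ((i : ℕ) : ℝ) = ((i : ℕ) : ℝ) ^ (r + 1) * ‖a.1 i‖ := by ring
      _ ≤ N * (ε / 2) := h1.trans hN.le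
      _ ≤ ε / 2 * ((i : ℕ) : ℝ) := by rw [mul_comm]; gcongr

/-- The map `a ↦ (i ^ r * a i)_i` to the space of bounded sequences. -/
def toBounded (r : ℕ) : RapidSeq →ₗ[ℂ] lp (fun _ : ℕ+ => ℂ) ∞ :=
  (WeightedLp.toLp ∞ (-(r : ℤ))).comp (toWeighted r)

theorem toBounded_apply (r : ℕ) (a : RapidSeq) (i : ℕ+) :
    toBounded r a i = ((i : ℕ) : ℂ) ^ r * a.1 i := by
  change weight (-(r : ℤ)) a.1 i = _
  simp [weight]

theorem continuous_toBounded (r : ℕ) : Continuous (toBounded r) :=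
  withSeminorms_rapid.continuous_normedSpace_rng _ _ ⟨{r}, 1, fun a => by
    rw [one_smul, Finset.sup_singleton]
    exact le_rfl⟩

end RapidSeq

/-! ### Continuous linear maps on projective tensor products -/

namespace ProjTensor

variable {E F G : Type*} [AddCommGroup E] [Module ℂ E] [AddCommGroup F] [Module ℂ F]

@[elab_as_elim]
theorem induction_on {P : ProjTensor E F → Prop} (z : ProjTensor E F) (zero : P 0)
    (mk : ∀ a b, P (ProjTensor.mk E F a b)) (add : ∀ y z, P y → P z → P (y + z)) : P z :=
  TensorProduct.induction_on z zero mk add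

/-- The linear map on the algebraic tensor product given by a bilinear map. -/
def liftLinear [AddCommGroup G] [Module ℂ G] (B : E →ₗ[ℂ] F →ₗ[ℂ] G) : ProjTensor E F →ₗ[ℂ] G := TensorProduct.lift B

theorem liftLinear_mk [AddCommGroup G] [Module ℂ G] (B : E →ₗ[ℂ] F →ₗ[ℂ] G) (a : E)
    (b : F) : liftLinear B (mk E F a b) = B a b :=
  TensorProduct.lift.tmul a b

/-- The topology induced by the lift competes in the `sInf` that defines the projective topology. -/
theorem continuous_liftLinear [TopologicalSpace E] [TopologicalSpace F] [NormedAddCommGroup G]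
    [NormedSpace ℂ G] (B : E →ₗ[ℂ] F →ₗ[ℂ] G)
    (hB : Continuous fun x : E × F => B x.1 x.2) : Continuous (liftLinear B) := by
  refine continuous_iff_le_induced.2 (sInf_le ⟨⟨?_, ?_, ?_⟩, ?_⟩)
  · exact topologicalAddGroup_induced (liftLinear B)
  · exact continuousSMul_induced (liftLinear B)
  · exact LocallyConvexSpace.induced ((liftLinear B).restrictScalars ℝ)
  · refine continuous_induced_rng.2 ?_
    exact hB.congr fun x => (liftLinear_mk B x.1 x.2).symm

end ProjTensor

/-! ### The completed tensor product of `s` and a Banach space -/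

namespace RapidTensor

variable (X : Type*) [NormedAddCommGroup X] [NormedSpace ℂ X]

theorem norm_smul_apply_le (a : lp (fun _ : ℕ+ => ℂ) ∞) (y : X) (i : ℕ+) :
    ‖a i • y‖ ≤ ‖a‖ * ‖y‖ := by
  rw [norm_smul]
  gcongr
  exact lp.norm_apply_le_norm ENNReal.top_ne_zero a i

/-- The bounded sequence `(a i • y)_i`. -/
def smulSequence (a : lp (fun _ : ℕ+ => ℂ) ∞) (y : X) : lp (fun _ : ℕ+ => X) ∞ :=
  ⟨fun i => a i • y, memℓp_infty ⟨‖a‖ * ‖y‖, by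
    rintro _ ⟨i, rfl⟩
    exact norm_smul_apply_le X a y i⟩⟩

theorem smulSequence_apply (a : lp (fun _ : ℕ+ => ℂ) ∞) (y : X) (i : ℕ+) :
    smulSequence X a y i = a i • y := rfl

/-- The map `(a, y) ↦ (a i • y)_i` for bounded sequences `a`. -/
def smulBilinear : lp (fun _ : ℕ+ => ℂ) ∞ →L[ℂ] X →L[ℂ] lp (fun _ : ℕ+ => X) ∞ :=
  LinearMap.mkContinuous₂
    (LinearMap.mk₂ ℂ (smulSequence X)
      (fun a b y => lp.ext (funext fun i => by
        simp only [smulSequence_apply, lp.coeFn_add, Pi.add_apply, add_smul]))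
      (fun c a y => lp.ext (funext fun i => by
        simp only [smulSequence_apply, lp.coeFn_smul, Pi.smul_apply, smul_assoc]))
      (fun a y z => lp.ext (funext fun i => by
        simp only [smulSequence_apply, lp.coeFn_add, Pi.add_apply, smul_add]))
      (fun c a y => lp.ext (funext fun i => by
        simp only [smulSequence_apply, lp.coeFn_smul, Pi.smul_apply, smul_comm c])))
    1 fun a y => by
      rw [one_mul]
      exact lp.norm_le_of_forall_le (by positivity) (norm_smul_apply_le X a y)

/-- The bilinear map `(a, y) ↦ (i ^ r * a i • y)_i`. -/
def bilinear (r : ℕ) : RapidSeq →ₗ[ℂ] X →ₗ[ℂ] lp (fun _ : ℕ+ => X) ∞ :=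
  LinearMap.mk₂ ℂ (fun a y => smulBilinear X (RapidSeq.toBounded r a) y)
    (fun a b y => by rw [map_add, map_add, add_apply])
    (fun c a y => by rw [map_smul, map_smul, smul_apply])
    (fun a y z => map_add _ y z)
    (fun c a y => map_smul _ c y)

theorem bilinear_apply (r : ℕ) (a : RapidSeq) (y : X) (i : ℕ+) :
    bilinear X r a y i = (((i : ℕ) : ℂ) ^ r * a.1 i) • y := by
  rw [← RapidSeq.toBounded_apply]
  rfl

/-- The continuous linear map that takes `a ⊗ y` to `(i ^ r * a i • y)_i`. -/
def projCoord (r : ℕ) : ProjTensor RapidSeq X →L[ℂ] lp (fun _ : ℕ+ => X) ∞ where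
  toLinearMap := ProjTensor.liftLinear (bilinear X r)
  cont := ProjTensor.continuous_liftLinear _ ((smulBilinear X).continuous₂.comp
    (((RapidSeq.continuous_toBounded r).comp continuous_fst).prodMk continuous_snd))

theorem projCoord_mk (r : ℕ) (a : RapidSeq) (y : X) (i : ℕ+) :
    projCoord X r (ProjTensor.mk RapidSeq X a y) i = (((i : ℕ) : ℂ) ^ r * a.1 i) • y := by
  rw [← bilinear_apply]
  exact congrArg (fun z : lp (fun _ : ℕ+ => X) ∞ => z i) (ProjTensor.liftLinear_mk _ a y)

theorem projCoord_apply (r : ℕ) (z : ProjTensor RapidSeq X) (i : ℕ+) :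
    projCoord X r z i = ((i : ℕ) : ℂ) ^ r • projCoord X 0 z i := by
  induction z using ProjTensor.induction_on with
  | zero => simp
  | mk a y => rw [projCoord_mk, projCoord_mk, smul_smul, pow_zero, one_mul]
  | add y z hy hz => rw [map_add, map_add, lp.coeFn_add, lp.coeFn_add, Pi.add_apply, Pi.add_apply,
      hy, hz, smul_add]

/-- By linearity only `a ⊗ y` matters, where this is the expansion of `a` in unit vectors tensored
with `y`. -/
theorem hasSum_projCoord (z : ProjTensor RapidSeq X) :
    HasSum (fun i => ProjTensor.mk RapidSeq X (RapidSeq.unit i) (projCoord X 0 z i)) z := by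
  induction z using ProjTensor.induction_on with
  | zero => simp
  | mk a y =>
    have hc : Continuous fun b => ProjTensor.mk RapidSeq X b y :=
      (ProjTensor.continuous_mk RapidSeq X).comp (continuous_id.prodMk continuous_const)
    refine ((RapidSeq.hasSum_unit a).map ((ProjTensor.mk RapidSeq X).flip y) hc).congr_fun
      fun i => ?_
    rw [projCoord_mk, pow_zero, one_mul, Function.comp_apply, LinearMap.flip_apply, map_smul,
      map_smul, LinearMap.smul_apply]
  | add y z hy hz =>
    refine (hy.add hz).congr_fun fun i => ?_
    rw [map_add, lp.coeFn_add, Pi.add_apply, map_add]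

/-- Continuity at the origin gives `p < 1` on a product of balls; `unit i` and `y` are scaled into
these, to half the radii, and homogeneity does the rest. -/
theorem exists_seminorm_mk_unit_le {p : Seminorm ℂ (ProjTensor RapidSeq X)} (hp : Continuous p) :
    ∃ (r : ℕ) (C : ℝ), 0 ≤ C ∧ ∀ i y,
      p (ProjTensor.mk RapidSeq X (RapidSeq.unit i) y) ≤ C * ((i : ℕ) : ℝ) ^ r * ‖y‖ := by
  have hc := (hp.comp (ProjTensor.continuous_mk RapidSeq X)).tendsto (0, 0)
  have h0 : {x : RapidSeq × X | p (ProjTensor.mk RapidSeq X x.1 x.2) < 1} ∈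
      𝓝 (0 : RapidSeq) ×ˢ 𝓝 (0 : X) := by
    rw [← nhds_prod_eq]
    exact hc.eventually_lt_const (by simp)
  obtain ⟨⟨⟨s, ε⟩, δ⟩, ⟨hε, hδ⟩, hs⟩ :=
    (withSeminorms_rapid.hasBasis_zero_ball.prod Metric.nhds_basis_ball).mem_iff.1 h0
  dsimp only at hε hδ hs
  refine ⟨s.sup id, (ε / 2)⁻¹ * (δ / 2)⁻¹, by positivity, fun i y => ?_⟩
  have hi : 0 < ((i : ℕ) : ℝ) ^ s.sup id := pow_pos (PNat.cast_real_pos i) _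
  rcases eq_or_ne y 0 with rfl | hy
  · simp
  have hy0 := norm_pos_iff.2 hy
  have hu : (s.sup rapidSeminorms) (RapidSeq.unit i) ≤ ((i : ℕ) : ℝ) ^ s.sup id :=
    Seminorm.finset_sup_apply_le hi.le fun r hr =>
      (RapidSeq.rapidSeminorms_unit_le r i).trans
        (pow_le_pow_right₀ (PNat.one_le_cast_real i) (Finset.le_sup (f := id) hr))
  set c : ℝ := (ε / 2) / ((i : ℕ) : ℝ) ^ s.sup id with hcdef
  set d : ℝ := (δ / 2) / ‖y‖ with hddef
  have hc0 : 0 < c := by positivity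
  have hd0 : 0 < d := by positivity
  have hmem : ((c : ℂ) • RapidSeq.unit i, (d : ℂ) • y) ∈
      (s.sup rapidSeminorms).ball 0 ε ×ˢ Metric.ball (0 : X) δ := by
    constructor
    · rw [Seminorm.mem_ball_zero, map_smul_eq_mul, Complex.norm_real, Real.norm_of_nonneg hc0.le]
      calc c * _ ≤ c * ((i : ℕ) : ℝ) ^ s.sup id := by gcongr
        _ = ε / 2 := div_mul_cancel₀ _ hi.ne'
        _ < ε := half_lt_self hε
    · rw [mem_ball_zero_iff, norm_smul, Complex.norm_real, Real.norm_of_nonneg hd0.le,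
        div_mul_cancel₀ _ hy0.ne']
      exact half_lt_self hδ
  have h1 : p (ProjTensor.mk RapidSeq X ((c : ℂ) • RapidSeq.unit i) ((d : ℂ) • y)) ≤ 1 :=
    (Set.mem_ofPred.1 (hs hmem)).le
  rw [LinearMap.map_smul, LinearMap.map_smul, LinearMap.smul_apply, map_smul_eq_mul,
    map_smul_eq_mul, Complex.norm_real, Complex.norm_real, Real.norm_of_nonneg hc0.le,
    Real.norm_of_nonneg hd0.le, ← mul_assoc, ← le_div_iff₀' (by positivity)] at h1
  refine h1.trans_eq ?_
  rw [hcdef, hddef]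
  field_simp

/-- The projective topology is no finer than that of the seminorms `‖projCoord X r z‖`: the
expansion of `z` gives `p z ≤ C * ∑ i ^ r * ‖z i‖ ≤ C * S * ‖projCoord X (r + 2) z‖`. -/
theorem exists_projCoord_subset {U : Set (ProjTensor RapidSeq X)} (hU : U ∈ 𝓝 0) :
    ∃ r : ℕ, ∃ ε > 0, ∀ z, ‖projCoord X r z‖ < ε → z ∈ U := by
  obtain ⟨p, hp, hpU⟩ := exists_continuous_seminorm_ball_subset hU
  obtain ⟨r, C, hC, h⟩ := exists_seminorm_mk_unit_le X hp
  set S := ∑' i : ℕ+, (((i : ℕ) : ℝ) ^ 2)⁻¹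
  have hS : 0 ≤ S := tsum_nonneg fun _ => by positivity
  refine ⟨r + 2, (C * S + 1)⁻¹, by positivity, fun z hz => hpU z ?_⟩
  have hle : ∀ i, p (ProjTensor.mk RapidSeq X (RapidSeq.unit i) (projCoord X 0 z i)) ≤
      C * ‖projCoord X (r + 2) z‖ * (((i : ℕ) : ℝ) ^ 2)⁻¹ := by
    intro i
    have hi := PNat.cast_real_pos i
    refine (h i _).trans ?_
    have h1 := lp.norm_apply_le_norm ENNReal.top_ne_zero (projCoord X (r + 2) z) i
    rw [projCoord_apply, norm_smul, norm_pow, Complex.norm_natCast] at h1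
    rw [← div_eq_mul_inv, le_div_iff₀ (by positivity)]
    calc C * ((i : ℕ) : ℝ) ^ r * ‖projCoord X 0 z i‖ * ((i : ℕ) : ℝ) ^ 2
        = C * (((i : ℕ) : ℝ) ^ (r + 2) * ‖projCoord X 0 z i‖) := by ring
      _ ≤ C * ‖projCoord X (r + 2) z‖ := by gcongr
  have hsum := summable_pnat_inv_sq.mul_left (C * ‖projCoord X (r + 2) z‖)
  have hsum' := hsum.of_nonneg_of_le (fun _ => apply_nonneg p _) hle
  have h1 := (Seminorm.le_tsum_of_hasSum hp (hasSum_projCoord X z) hsum').trans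
    (hsum'.tsum_le_tsum hle hsum)
  rw [tsum_mul_left] at h1
  refine lt_of_le_of_lt h1 ?_
  calc C * ‖projCoord X (r + 2) z‖ * S = C * S * ‖projCoord X (r + 2) z‖ := by ring
    _ ≤ C * S * (C * S + 1)⁻¹ := by gcongr
    _ < 1 := by
      rw [← div_eq_mul_inv, div_lt_one (by positivity)]
      linarith

variable [CompleteSpace X]

/-- The extension of `a ⊗ y ↦ (i ^ r * a i • y)_i` to the completed tensor product. -/
def coord (r : ℕ) : CompletedTensor RapidSeq X →L[ℂ] lp (fun _ : ℕ+ => X) ∞ :=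
  (projCoord X r).fromCompletion

theorem coord_coe (r : ℕ) (z : ProjTensor RapidSeq X) :
    coord X r (z : CompletedTensor RapidSeq X) = projCoord X r z :=
  (projCoord X r).fromCompletion_apply_coe z

theorem coord_apply (r : ℕ) (x : CompletedTensor RapidSeq X) (i : ℕ+) :
    coord X r x i = ((i : ℕ) : ℂ) ^ r • coord X 0 x i := by
  have hc : ∀ r, Continuous fun x => coord X r x i := fun r =>
    (lp.evalCLM ℂ (fun _ : ℕ+ => X) ∞ i).continuous.comp (coord X r).continuous
  refine UniformSpace.Completion.induction_on x
    (isClosed_eq (hc r) ((hc 0).const_smul _)) fun z => ?_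
  rw [coord_coe, coord_coe, projCoord_apply]

/-- The seminorms `x ↦ sup i ^ r * ‖x i‖` on the completed tensor product. -/
def seminorms : SeminormFamily ℂ (CompletedTensor RapidSeq X) ℕ := fun r =>
  (normSeminorm ℂ (lp (fun _ : ℕ+ => X) ∞)).comp (coord X r).toLinearMap

theorem seminorms_apply (r : ℕ) (x : CompletedTensor RapidSeq X) :
    seminorms X r x = ‖coord X r x‖ := rfl

theorem continuous_seminorms (r : ℕ) : Continuous (seminorms X r) := (coord X r).continuous.norm

/-- To pass to the completion, a closed neighbourhood `V` is used: the open set where the seminorm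
is less than `ε` lies in the closure of its trace on the dense image, and that trace lies in `V`. -/
theorem withSeminorms : WithSeminorms (seminorms X) := by
  rw [SeminormFamily.withSeminorms_iff_nhds_eq_iInf]
  refine le_antisymm (le_iInf fun r => Filter.tendsto_iff_comap.1
    ((continuous_seminorms X r).tendsto' 0 0 (map_zero _))) fun U hU => ?_
  obtain ⟨V, ⟨hV, hVc⟩, hVU⟩ := (closed_nhds_basis (0 : CompletedTensor RapidSeq X)).mem_iff.1 hU
  have hV' : ((↑) : ProjTensor RapidSeq X → CompletedTensor RapidSeq X) ⁻¹' V ∈ 𝓝 0 :=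
    (UniformSpace.Completion.continuous_coe _).tendsto' 0 0 UniformSpace.Completion.coe_zero hV
  obtain ⟨r, ε, hε, h⟩ := exists_projCoord_subset X hV'
  refine Filter.mem_iInf_of_mem r (Filter.mem_of_superset
    (Filter.preimage_mem_comap (Iio_mem_nhds hε)) fun x hx => hVU ?_)
  have hopen : IsOpen (seminorms X r ⁻¹' Set.Iio ε) :=
    isOpen_Iio.preimage (continuous_seminorms X r)
  have hx' := UniformSpace.Completion.denseRange_coe.subset_closure_image_preimage_of_isOpen
    hopen hx
  refine hVc.closure_subset_iff.2 ?_ hx'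
  rintro _ ⟨z, hz, rfl⟩
  refine h z ?_
  rw [← coord_coe]
  exact hz

/-- The completion is Hausdorff, so the seminorms separate points, and `coord X 0` determines every
`coord X r`. The injectivity of the linking maps rests on this. -/
theorem coord_zero_injective : Function.Injective (coord X 0) := by
  rw [injective_iff_map_eq_zero]
  intro x hx
  by_contra hne
  obtain ⟨r, hr⟩ := (withSeminorms X).separating_of_T1 x hne
  refine hr ?_
  rw [seminorms_apply, norm_eq_zero]
  refine lp.ext (funext fun i => ?_)
  rw [coord_apply, hx]
  simp

end RapidTensor

/-! ### Banach spaces of sequences -/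

/-- A realization of the normed space `X` as a space of sequences, with norm behaving like
a weighted norm with weight `j ^ (-k)` on the coordinates and the unit vectors. -/
structure SequenceCoordinates (k : ℤ) (X : Type*) [NormedAddCommGroup X] [NormedSpace ℂ X] where
  coord : X →ₗ[ℂ] (ℕ+ → ℂ)
  unit : ℕ+ → X
  coord_injective : Function.Injective coord
  coord_unit : ∀ i j, coord (unit i) j = if j = i then 1 else 0
  coord_le : ∀ x (j : ℕ+), ‖coord x j‖ ≤ ((j : ℕ) : ℝ) ^ k * ‖x‖
  norm_unit_le : ∀ j : ℕ+, ‖unit j‖ ≤ ((j : ℕ) : ℝ) ^ (-k)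

namespace SequenceCoordinates

variable {k : ℤ} {X : Type*} [NormedAddCommGroup X] [NormedSpace ℂ X] [CompleteSpace X]

/-- The double sequence realization of the completed tensor product of `s` with a Banach space of
sequences. -/
def tensor (S : SequenceCoordinates k X) :
    MatrixCoordinates k (CompletedTensor RapidSeq X) where
  seminorm := RapidTensor.seminorms X
  withSeminorms := RapidTensor.withSeminorms X
  coord :=
    { toFun := fun x a => S.coord (RapidTensor.coord X 0 x a.1) a.2
      map_add' := fun x y => by
        funext a
        rw [map_add, lp.coeFn_add, Pi.add_apply, map_add]
        rfl
      map_smul' := fun c x => by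
        funext a
        rw [map_smul, lp.coeFn_smul, Pi.smul_apply, map_smul]
        rfl }
  unit a := (ProjTensor.mk RapidSeq X (RapidSeq.unit a.1) (S.unit a.2) : ProjTensor RapidSeq X)
  coord_injective x y h := by
    refine RapidTensor.coord_zero_injective X (lp.ext (funext fun i => S.coord_injective ?_))
    exact funext fun j => congrFun h (i, j)
  coord_unit a b := by
    change S.coord (RapidTensor.coord X 0 _ b.1) b.2 = _
    rw [RapidTensor.coord_coe, RapidTensor.projCoord_mk, map_smul, Pi.smul_apply, S.coord_unit,
      RapidSeq.unit_apply, pow_zero, one_mul]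
    simp only [Prod.ext_iff]
    split_ifs <;> simp_all
  coord_le r x a := by
    have h1 := S.coord_le (RapidTensor.coord X 0 x a.1) a.2
    have h2 := lp.norm_apply_le_norm ENNReal.top_ne_zero (RapidTensor.coord X r x) a.1
    rw [RapidTensor.coord_apply, norm_smul, norm_pow, Complex.norm_natCast] at h2
    have hj : 0 < ((a.2 : ℕ) : ℝ) ^ k := zpow_pos (PNat.cast_real_pos _) _
    calc ((a.1 : ℕ) : ℝ) ^ r * ‖S.coord (RapidTensor.coord X 0 x a.1) a.2‖
        ≤ ((a.1 : ℕ) : ℝ) ^ r * (((a.2 : ℕ) : ℝ) ^ k * ‖RapidTensor.coord X 0 x a.1‖) := by gcongr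
      _ = ((a.2 : ℕ) : ℝ) ^ k * (((a.1 : ℕ) : ℝ) ^ r * ‖RapidTensor.coord X 0 x a.1‖) := by ring
      _ ≤ ((a.2 : ℕ) : ℝ) ^ k * ‖RapidTensor.coord X r x‖ := by gcongr
  seminorm_unit_le r a := by
    rw [RapidTensor.seminorms_apply, RapidTensor.coord_coe]
    have hj : 0 < ((a.2 : ℕ) : ℝ) ^ (-k) := zpow_pos (PNat.cast_real_pos _) _
    refine lp.norm_le_of_forall_le (by positivity) fun i => ?_
    rw [RapidTensor.projCoord_mk, norm_smul, norm_mul, norm_pow, Complex.norm_natCast]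
    refine mul_le_mul ?_ (S.norm_unit_le a.2) (norm_nonneg _) (by positivity)
    rw [RapidSeq.unit_apply]
    split_ifs with h
    · simp [h]
    · simp

theorem tensor_coord_apply (S : SequenceCoordinates k X) (x : CompletedTensor RapidSeq X)
    (a : ℕ+ × ℕ+) : S.tensor.coord x a = S.coord (RapidTensor.coord X 0 x a.1) a.2 := rfl

/-- Both sides are continuous in `x`, which reduces the claim to elementary tensors. This
compatibility glues the coordinates on the inductive limit. -/
theorem tensor_coord_lTensor {l : ℤ} {Y : Type*} [NormedAddCommGroup Y] [NormedSpace ℂ Y]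
    [CompleteSpace Y] (S : SequenceCoordinates k X) (T : SequenceCoordinates l Y) (g : X →L[ℂ] Y)
    (hg : ∀ x, T.coord (g x) = S.coord x) (x : CompletedTensor RapidSeq X) :
    T.tensor.coord (CompletedTensor.lTensor RapidSeq g x) = S.tensor.coord x := by
  funext a
  refine UniformSpace.Completion.induction_on x (isClosed_eq
    ((T.tensor.continuous_coord a).comp (CompletedTensor.lTensor RapidSeq g).continuous)
    (S.tensor.continuous_coord a)) fun z => ?_
  have hz : CompletedTensor.lTensor RapidSeq g (z : CompletedTensor RapidSeq X) =
      (ProjTensor.lTensor RapidSeq g z : ProjTensor RapidSeq Y) :=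
    ProjTensor.completion_map_coe RapidSeq g z
  rw [hz, tensor_coord_apply, tensor_coord_apply, RapidTensor.coord_coe, RapidTensor.coord_coe]
  clear hz
  induction z using ProjTensor.induction_on with
  | zero => simp
  | mk b y =>
    have hm : ProjTensor.lTensor RapidSeq g (ProjTensor.mk RapidSeq X b y) =
        ProjTensor.mk RapidSeq Y b (g y) := LinearMap.lTensor_tmul _ _ _ _
    rw [hm, RapidTensor.projCoord_mk, RapidTensor.projCoord_mk, map_smul, map_smul, hg]
  | add y z hy hz =>
    simp only [map_add, lp.coeFn_add, Pi.add_apply, hy, hz]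

end SequenceCoordinates

/-! ### The weighted sequence spaces as Banach spaces of sequences -/

theorem weight_apply (k : ℤ) (x : ℕ+ → ℂ) (j : ℕ+) :
    weight k x j = ((j : ℕ) : ℂ) ^ (-k) * x j := rfl

theorem weight_weight_neg (k : ℤ) (x : ℕ+ → ℂ) : weight k (weight (-k) x) = x := by
  funext j
  have hj : ((j : ℕ) : ℂ) ≠ 0 := Nat.cast_ne_zero.2 j.ne_zero
  rw [weight_apply, weight_apply, ← mul_assoc, ← zpow_add₀ hj]
  simp

theorem weight_single (k : ℤ) (i : ℕ+) :
    weight k (Pi.single i 1) = Pi.single i (((i : ℕ) : ℂ) ^ (-k)) := by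
  funext j
  rw [weight_apply, Pi.single_apply, Pi.single_apply]
  split_ifs with h
  · rw [h, mul_one]
  · rw [mul_zero]

theorem norm_eq_zpow_mul_norm_weight (k : ℤ) (x : ℕ+ → ℂ) (j : ℕ+) :
    ‖x j‖ = ((j : ℕ) : ℝ) ^ k * ‖weight k x j‖ := by
  have hj := (PNat.cast_real_pos j).ne'
  rw [weight_apply, norm_mul, norm_zpow, Complex.norm_natCast, ← mul_assoc, ← zpow_add₀ hj]
  simp

namespace WeightedLp

variable (p : ℝ≥0∞) (k : ℤ)

/-- The inclusion of `(ℓ^p)_{-k}` in the space of all sequences. -/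
def toSequence : WeightedLp p k →ₗ[ℂ] (ℕ+ → ℂ) := (weightedLpSubmodule p k).subtype

theorem toSequence_injective : Function.Injective (toSequence p k) := Subtype.val_injective

theorem toLp_surjective : Function.Surjective (toLp p k) := fun y =>
  ⟨⟨weight (-k) y, by
    change Memℓp (weight k (weight (-k) y)) p
    rw [weight_weight_neg]
    exact lp.memℓp y⟩, lp.ext (weight_weight_neg k y)⟩

/-- The unit vectors of `(ℓ^p)_{-k}`. -/
def unit (i : ℕ+) : WeightedLp p k :=
  ⟨Pi.single i 1, by
    change Memℓp (weight k (Pi.single i 1)) p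
    rw [weight_single, ← lp.coeFn_single (E := fun _ => ℂ) p]
    exact lp.memℓp _⟩

theorem toLp_unit (i : ℕ+) : toLp p k (unit p k i) = lp.single p i (((i : ℕ) : ℂ) ^ (-k)) :=
  lp.ext ((weight_single k i).trans (lp.coeFn_single (E := fun _ => ℂ) p i _).symm)

theorem toSequence_unit (i j : ℕ+) : toSequence p k (unit p k i) j = if j = i then 1 else 0 :=
  Pi.single_apply i 1 j

variable [Fact (1 ≤ p)]

theorem norm_toLp (x : WeightedLp p k) : ‖toLp p k x‖ = ‖x‖ := rfl

instance : CompleteSpace (WeightedLp p k) :=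
  ((AddMonoidHomClass.isometry_of_norm (toLp p k)
    (norm_toLp p k)).isUniformInducing.completeSpace_congr (toLp_surjective p k)).2 inferInstance

theorem norm_apply_le (x : WeightedLp p k) (j : ℕ+) : ‖weight k (toSequence p k x) j‖ ≤ ‖x‖ :=
  lp.norm_apply_le_norm (zero_lt_one.trans_le (Fact.out : 1 ≤ p)).ne' (toLp p k x) j

theorem norm_toSequence_le (x : WeightedLp p k) (j : ℕ+) :
    ‖toSequence p k x j‖ ≤ ((j : ℕ) : ℝ) ^ k * ‖x‖ := by
  rw [norm_eq_zpow_mul_norm_weight k]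
  exact mul_le_mul_of_nonneg_left (norm_apply_le p k x j)
    (zpow_pos (PNat.cast_real_pos j) k).le

theorem norm_unit_le (j : ℕ+) : ‖unit p k j‖ ≤ ((j : ℕ) : ℝ) ^ (-k) := by
  rw [← norm_toLp, toLp_unit, lp.norm_single (zero_lt_one.trans_le (Fact.out : 1 ≤ p)), norm_zpow,
    Complex.norm_natCast]

/-- `(ℓ^p)_{-k}` as a Banach space of sequences. -/
def sequenceCoordinates : SequenceCoordinates k (WeightedLp p k) where
  coord := toSequence p k
  unit := unit p k
  coord_injective := toSequence_injective p k
  coord_unit := toSequence_unit p k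
  coord_le := norm_toSequence_le p k
  norm_unit_le := norm_unit_le p k

end WeightedLp

namespace WeightedC0

variable (k : ℤ)

theorem isClosed : IsClosed (WeightedC0 k : Set (WeightedLp ∞ k)) := by
  refine isClosed_of_closure_subset fun x hx => ?_
  refine Metric.tendsto_nhds.2 fun ε hε => ?_
  obtain ⟨y, hy, hxy⟩ := Metric.mem_closure_iff.1 hx (ε / 2) (half_pos hε)
  have hy' : Filter.Tendsto (weight k y.1) Filter.cofinite (𝓝 0) := hy
  filter_upwards [Metric.tendsto_nhds.1 hy' (ε / 2) (half_pos hε)] with j hj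
  have h1 := WeightedLp.norm_apply_le ∞ k (x - y) j
  rw [map_sub, map_sub, Pi.sub_apply] at h1
  rw [dist_eq_norm] at hxy
  rw [dist_zero_right] at hj ⊢
  calc ‖weight k x.1 j‖ ≤ ‖weight k x.1 j - weight k y.1 j‖ + ‖weight k y.1 j‖ := by
        simpa using norm_add_le (weight k x.1 j - weight k y.1 j) (weight k y.1 j)
    _ < ε / 2 + ε / 2 := add_lt_add (h1.trans_lt hxy) hj
    _ = ε := add_halves ε

instance : CompleteSpace (WeightedC0 k) := (isClosed k).completeSpace_coe

/-- The unit vectors of `(c_0)_{-k}`. -/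
def unit (i : ℕ+) : WeightedC0 k :=
  ⟨WeightedLp.unit ∞ k i, by
    change Filter.Tendsto (weight k (Pi.single i 1)) Filter.cofinite (𝓝 0)
    refine tendsto_nhds_of_eventually_eq ?_
    filter_upwards [(Set.finite_singleton i).compl_mem_cofinite] with j hj
    rw [weight_single, Pi.single_eq_of_ne hj]⟩

/-- `(c_0)_{-k}` as a Banach space of sequences. -/
def sequenceCoordinates : SequenceCoordinates k (WeightedC0 k) where
  coord := (WeightedLp.toSequence ∞ k).comp (WeightedC0 k).subtype
  unit := unit k
  coord_injective := (WeightedLp.toSequence_injective ∞ k).comp Subtype.val_injective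
  coord_unit := WeightedLp.toSequence_unit ∞ k
  coord_le x := WeightedLp.norm_toSequence_le ∞ k x
  norm_unit_le := WeightedLp.norm_unit_le ∞ k

end WeightedC0

theorem WeightedLp.toSequence_incl (p : ℝ≥0∞) [Fact (1 ≤ p)] {k l : ℤ} (h : k ≤ l)
    (x : WeightedLp p k) :
    WeightedLp.toSequence p l (WeightedLp.incl p h x) = WeightedLp.toSequence p k x :=
  Submodule.coe_inclusion (p := weightedLpSubmodule p k) (p' := weightedLpSubmodule p l)
    (fun _ => mem_weightedLp_of_le p h) x

theorem WeightedC0.toSequence_incl {k l : ℤ} (h : k ≤ l) (x : WeightedC0 k) :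
    WeightedLp.toSequence ∞ l (WeightedC0.incl h x : WeightedLp ∞ l) =
      WeightedLp.toSequence ∞ k (x : WeightedLp ∞ k) :=
  WeightedLp.toSequence_incl ∞ h x.1

/-- The steps `s ⊗ (ℓ^p)_{-k}` as spaces of double sequences. -/
def lpStepCoordinates (p : ℝ≥0∞) [Fact (1 ≤ p)] (k : ℤ) : MatrixCoordinates k (LpStep p k) :=
  (WeightedLp.sequenceCoordinates p k).tensor

theorem lpStepCoordinates_coord_lpLink (p : ℝ≥0∞) [Fact (1 ≤ p)] (k l : ℤ) (h : k ≤ l)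
    (x : LpStep p k) :
    (lpStepCoordinates p l).coord (lpLink p k l h x) = (lpStepCoordinates p k).coord x :=
  SequenceCoordinates.tensor_coord_lTensor (WeightedLp.sequenceCoordinates p k)
    (WeightedLp.sequenceCoordinates p l) (WeightedLp.incl p h) (WeightedLp.toSequence_incl p h) x

/-- The steps `s ⊗ (c_0)_{-k}` as spaces of double sequences. -/
def c0StepCoordinates (k : ℤ) : MatrixCoordinates k (C0Step k) :=
  (WeightedC0.sequenceCoordinates k).tensor

theorem c0StepCoordinates_coord_c0Link (k l : ℤ) (h : k ≤ l) (x : C0Step k) :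
    (c0StepCoordinates l).coord (c0Link k l h x) = (c0StepCoordinates k).coord x :=
  SequenceCoordinates.tensor_coord_lTensor (WeightedC0.sequenceCoordinates k)
    (WeightedC0.sequenceCoordinates l) (WeightedC0.incl h) (WeightedC0.toSequence_incl h) x

theorem proposition2p2 :
    (∀ (p : ℝ≥0∞) [Fact (1 ≤ p)],
      IsLFSpace (LpStep p) (lpLink p) ∧
      IsCompactlyRegular (LpStep p) (lpLink p) ∧
      CompleteSpace (IndLim (LpStep p) (lpLink p))) ∧
    (IsLFSpace C0Step c0Link ∧
      IsCompactlyRegular C0Step c0Link ∧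
      CompleteSpace (IndLim C0Step c0Link)) := by
  constructor
  · intro p _
    have hf := lpStepCoordinates_coord_lpLink p
    exact ⟨IndLim.isLFSpace (lpStepCoordinates p) hf,
      IndLim.isCompactlyRegular (lpStepCoordinates p) hf,
      IndLim.completeSpace (lpStepCoordinates p) hf⟩
  · have hf := c0StepCoordinates_coord_c0Link
    exact ⟨IndLim.isLFSpace c0StepCoordinates hf, IndLim.isCompactlyRegular c0StepCoordinates hf,
      IndLim.completeSpace c0StepCoordinates hf⟩

end
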